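/- Let $k,n\ge 1$, let $Z_1,Z_2,\dots$ be independent real random variables on a probability space $(\Omega,\mathcal A,P)$, and let $h_1,\dots,h_n:\mathbb R^k\to\mathbb Z$ be measurable. Suppose that the random variables $X_i=h_i(Z_i,\dots,Z_{i+k-1})$, $1\le i\le n$, are non-negative and have finite second moments (so that $X_1,\dots,X_n$ are $k$-dependent), and put $X_i=0$ for $i<1$. Write $p_i=P(X_i\ne 0)$, let $G_i$ be the conditional distribution of $X_i$ given $X_i\neq 0$, and let $$\lambda_n=\sum_{i=1}^n p_i,\qquad F_n=\sum_{i=1}^n\frac{p_i}{\lambda_n}G_i .$$ Here $\mathrm{CP}(\lambda,F)$ is the compound Poisson distribution, that is, the distribution of $\sum_{j=1}^{M}W_j$ with $M\sim\mathrm{Po}(\lambda)$ and $W_1,W_2,\dots$ i.i.d. with distribution $F$, independent of $M$; $\mathrm{CP}(0,\cdot)$ is the point mass at $0$, so that the choice of $G_i$ when $p_i=0$, or of $F_n$ when $\lambda_n=0$, is irrelevant. Let $N_1,\dots,N_n$ be independent integer-valued random variables, independent of $(Z_j)_{j\ge1}$, with $N_i\sim \mathrm{CP}(p_i,G_i)$.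 For distributions on $\mathbb Z$ let $d_{\mathrm{TV}}(\mathcal L X,\mathcal L Y)=\sup_{A\subseteq\mathbb Z}|P(X\in A)-P(Y\in A)|$ and $$\zeta_2(\mathcal L X,\mathcal L Y)=\sum_{r\in\mathbb Z}\Bigl|\sum_{u\ge r}\bigl(F_X(u)-F_Y(u)\bigr)\Bigr| ,$$ where $F_X,F_Y$ are the cumulative distribution functions. For $f:\mathbb Z\to\mathbb R$ let $\Delta f(i)=f(i)-f(i-1)$, $\Delta^2f=\Delta(\Delta f)$ and $\|f\|_1=\sum_{z\in\mathbb Z}|f(z)|$; $f_{\mathrm{CP}(\lambda,F)}$ denotes the probability function of $\mathrm{CP}(\lambda,F)$. Empty sums are $0$. If $$m:=\max_{1\le i\le n}\ \sum_{j=i-3k+3}^{i}p_j<\log 2 ,$$ then $$d_{\mathrm{TV}}\Bigl(\mathcal L\sum_{i=1}^nX_i,\ \mathrm{CP}(\lambda_n,F_n)\Bigr)\le C_n+\frac{\|\Delta^2f_{\mathrm{CP}(\lambda_n,F_n)}\|_1}{2\bigl(1-2(1-e^{-m})\bigr)}\sum_{i=1}^n\zeta_2\Bigl(\mathcal L\sum_{j=i-2k+2}^{i}X_j,\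 \mathcal L\Bigl(\sum_{j=i-2k+2}^{i-1}X_j+N_i\Bigr)\Bigr),$$ where $$C_n=2\sum_{i=1}^n\Bigl(d_{\mathrm{TV}}\Bigl(\mathcal L\sum_{j=1}^{i-3k+2}X_j,\ \mathcal L\sum_{j=1}^{i-3k+2}N_j\Bigr)+\sum_{j=i-3k+3}^{i-2k+1}p_j\Bigr)\Bigl(2P\bigl((X_{i-k+1},\dots,X_{i-1})\neq \mathbf 0,\ X_i\ne 0\bigr)+2p_i\sum_{j=i-k+1}^{i-1}p_j+p_i^2\Bigr).$$ -/

import Mathlib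

open MeasureTheory ProbabilityTheory

noncomputable section

namespace CPApprox

/-- Total variation distance of two distributions on `ℤ`: `sup_{A ⊆ ℤ} |μ(A) - ν(A)|`. -/
def tvDist (μ ν : Measure ℤ) : ℝ :=
  ⨆ A : Set ℤ, |μ.real A - ν.real A|

/-- Zolotarev's metric of order two, in its discrete form, for two distributions on `ℤ`:
`∑_{k ∈ ℤ} |∑_{u ≥ k} (F_μ(u) - F_ν(u))|`, where `F_μ(u) = μ((-∞, u])`. -/
def zeta2 (μ ν : Measure ℤ) : ℝ :=
  ∑' k : ℤ, |∑' u : Set.Ici k, (μ.real (Set.Iic (u : ℤ)) - ν.real (Set.Iic (u : ℤ)))|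

/-- The backward difference `Δf(i) = f(i) - f(i - 1)`. -/
def bdiff (f : ℤ → ℝ) : ℤ → ℝ := fun i => f i - f (i - 1)

/-- The `L₁` norm `‖f‖₁ = ∑_{z ∈ ℤ} |f(z)|`. -/
def l1Norm (f : ℤ → ℝ) : ℝ := ∑' z : ℤ, |f z|

/-- The probability function `z ↦ μ({z})` of a distribution on `ℤ`. -/
def massFun (μ : Measure ℤ) : ℤ → ℝ := fun z => μ.real {z}

/-- The `j`-fold convolution power, i.e. the distribution of a sum of `j` independent random
variables with distribution `F` (the point mass at `0` if `j = 0`). -/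
def convPower (F : Measure ℤ) : ℕ → Measure ℤ
  | 0 => Measure.dirac 0
  | j + 1 => Measure.conv (convPower F j) F

/-- The compound Poisson distribution `CP(l, F)`: the distribution of the sum of `M` independent
random variables with distribution `F`, where `M` is an independent Poisson variable with mean
`l`; that is, `∑_j e^{-l} l^j / j! · F^{*j}`. -/
def compoundPoisson (l : ℝ) (F : Measure ℤ) : Measure ℤ :=
  Measure.sum fun j : ℕ =>
    ENNReal.ofReal (Real.exp (-l) * l ^ j / (Nat.factorial j : ℝ)) • convPower F j

variable {Ω : Type*} [MeasurableSpace Ω]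

/-- `P(Y ≠ 0)`. -/
def probNeZero (P : Measure Ω) (Y : Ω → ℤ) : ℝ := P.real {ω | Y ω ≠ 0}

/-- The conditional distribution of `Y` given `Y ≠ 0`
(the zero measure if `P(Y ≠ 0) = 0`, in which case `CP(P(Y ≠ 0), ·)` is the point mass at `0`
whatever the second argument). -/
def condLawNeZero (P : Measure Ω) (Y : Ω → ℤ) : Measure ℤ :=
  (cond P {ω | Y ω ≠ 0}).map Y

/-- `λ_n = ∑_{i=1}^n p_i` with `p_i = P(X_i ≠ 0)`. -/
def cpRate (P : Measure Ω) (X : ℤ → Ω → ℤ) (n : ℕ) : ℝ :=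
  ∑ i ∈ Finset.Icc (1 : ℤ) n, probNeZero P (X i)

/-- `F_n = ∑_{i=1}^n (p_i / λ_n) G_i`, with `G_i` the distribution of `X_i` given `X_i ≠ 0`. -/
def cpMix (P : Measure Ω) (X : ℤ → Ω → ℤ) (n : ℕ) : Measure ℤ :=
  ∑ i ∈ Finset.Icc (1 : ℤ) n,
    ENNReal.ofReal (probNeZero P (X i) / cpRate P X n) • condLawNeZero P (X i)

/-- The distribution of `∑_{j=a}^b Y_j` (an empty sum is `0`). -/
def lawSum (P : Measure Ω) (Y : ℤ → Ω → ℤ) (a b : ℤ) : Measure ℤ :=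
  P.map fun ω => ∑ j ∈ Finset.Icc a b, Y j ω

/-- The term
`C_n = 2 ∑_{i=1}^n (d_TV(L ∑_{j=1}^{i-3k+2} X_j, L ∑_{j=1}^{i-3k+2} N_j) + ∑_{j=i-3k+3}^{i-2k+1} p_j)
  · (2 P((X_{i-k+1}, …, X_{i-1}) ≠ 0, X_i ≠ 0) + 2 p_i ∑_{j=i-k+1}^{i-1} p_j + p_i²)`. -/
def cTerm (P : Measure Ω) (X N : ℤ → Ω → ℤ) (k n : ℕ) : ℝ :=
  2 * ∑ i ∈ Finset.Icc (1 : ℤ) n,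
    (tvDist (lawSum P X 1 (i - 3 * k + 2)) (lawSum P N 1 (i - 3 * k + 2))
        + ∑ j ∈ Finset.Icc (i - 3 * k + 3) (i - 2 * k + 1), probNeZero P (X j))
      * (2 * P.real {ω | (∃ j ∈ Finset.Icc (i - k + 1) (i - 1), X j ω ≠ 0) ∧ X i ω ≠ 0}
        + 2 * probNeZero P (X i) * ∑ j ∈ Finset.Icc (i - k + 1) (i - 1), probNeZero P (X j)
        + probNeZero P (X i) ^ 2)

end CPApprox

end

/-! The proof is Lindeberg's method. By `lawSum_eq_compoundPoisson` the target is the law of `N_1 +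
… + N_n`. Replacing the `X_i` by the `N_i` one at a time, from the right, telescopes the difference
into `n` comparisons of `S_{i-1} + X_i` with `S_{i-1} + N_i`, where `S_i = X_1 + … + X_i`, each
followed by the independent tail `N_{i+1} + … + N_n` with law `ν`.

In the `i`-th comparison `S_{i-1}` is cut into `A + B + U + V`, ending at the indices `i-3k+2`,
`i-2k+1`, `i-k`, `i-1`. As `X_j` sees only `Z_j, …, Z_{j+k-1}`, `A` is independent of `(U, V, X_i)`,
`B` of `(V, X_i)` and `A + B + U` of `X_i`. Subtracting a quantity of mean zero turns the integrand
into a second-order difference that vanishes when `V = 0`, up to an error `p_i²` from comparing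
`X_i` with `CP(p_i, G_i)`. It is thus dominated by a function of `(V, X_i)` alone, and `A + B` may
be exchanged for an independent variable with the law `ρ` of `N_1 + … + N_{i-3k+2}`; the cost is the
`i`-th term of `C_n` (`abs_lindeberg_exchange_le`, `abs_lindeberg_step_le`).

What remains compares `T + X_i` with `T + N_i`, `T = U + V`, after smoothing by `ρ * ν`. The means
agree and second moments are finite, so two summations by parts bound it by half of `‖Δ²‖₁` of `ρ *
ν` times `ζ₂` (`abs_conv_real_sub_le_zeta2`). Finally `ρ * ν` is `CP(λ_n, F_n)` with one block
missing. That block has an atom at `0` of mass at least `e^{-m} > 1/2`, so convolving it back costs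
at most the factor `1 - 2(1 - e^{-m})` (`l1Norm_bdiff_bdiff_le_conv`). -/

namespace CPApprox

/-! ### Convolution and differences of summable functions on `ℤ`. -/

/-- The convolution of two functions on `ℤ`. -/
noncomputable def seqConv (a b : ℤ → ℝ) : ℤ → ℝ := fun z => ∑' x, a (z - x) * b x

/-- The shear `(z, x) ↦ (z - x, x)` permutes `ℤ × ℤ`, so this is the product family reindexed. It
supplies Fubini for all convolution estimates. -/
lemma summable_seqConv_uncurry {a b : ℤ → ℝ} (ha : Summable a) (hb : Summable b) :
    Summable fun q : ℤ × ℤ => a (q.1 - q.2) * b q.2 := by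
  have h := summable_mul_of_summable_norm ha.norm hb.norm
  let e : ℤ × ℤ ≃ ℤ × ℤ :=
    { toFun := fun q => (q.1 - q.2, q.2)
      invFun := fun q => (q.1 + q.2, q.2)
      left_inv := fun q => by simp
      right_inv := fun q => by simp }
  exact e.summable_iff.mpr h

lemma summable_seqConv_term {a b : ℤ → ℝ} (ha : Summable a) (hb : Summable b) (z : ℤ) :
    Summable fun x => a (z - x) * b x :=
  (summable_seqConv_uncurry ha hb).prod_factor z

lemma summable_seqConv {a b : ℤ → ℝ} (ha : Summable a) (hb : Summable b) :
    Summable (seqConv a b) :=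
  (summable_seqConv_uncurry ha hb).prod

lemma l1Norm_seqConv_le {a b : ℤ → ℝ} (ha : Summable a) (hb : Summable b) :
    l1Norm (seqConv a b) ≤ l1Norm a * l1Norm b := by
  have hs := summable_seqConv_uncurry ha.abs hb.abs
  have h1 : l1Norm (seqConv a b) ≤ ∑' z, ∑' x, |a (z - x)| * |b x| := by
    refine (summable_seqConv ha hb).abs.tsum_le_tsum (fun z => ?_) hs.prod
    have ht := (summable_seqConv_term ha hb z).norm
    have := norm_tsum_le_tsum_norm ht
    simpa [seqConv, abs_mul] using this
  refine h1.trans (le_of_eq ?_)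
  rw [← Summable.tsum_comm (f := fun z x => |a (z - x)| * |b x|) hs]
  have h2 : ∀ x, ∑' z, |a (z - x)| * |b x| = l1Norm a * |b x| := fun x => by
    rw [tsum_mul_right]
    congr 1
    exact (Equiv.subRight x).tsum_eq fun z => |a z|
  rw [tsum_congr h2, tsum_mul_left]
  rfl

lemma summable_bdiff {a : ℤ → ℝ} (ha : Summable a) : Summable (bdiff a) :=
  ha.sub ((Equiv.subRight (1 : ℤ)).summable_iff.mpr ha)

lemma l1Norm_comp_add (a : ℤ → ℝ) (c : ℤ) : l1Norm (fun z => a (z + c)) = l1Norm a :=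
  (Equiv.addRight c).tsum_eq fun z => |a z|

lemma l1Norm_neg (a : ℤ → ℝ) : l1Norm (fun z => -a z) = l1Norm a := by
  simp [l1Norm]

lemma l1Norm_nonneg (a : ℤ → ℝ) : 0 ≤ l1Norm a := tsum_nonneg fun _ => abs_nonneg _

lemma bdiff_seqConv_left {a b : ℤ → ℝ} (ha : Summable a) (hb : Summable b) :
    bdiff (seqConv a b) = seqConv (bdiff a) b := by
  funext z
  simp only [bdiff, seqConv]
  rw [← (summable_seqConv_term ha hb z).tsum_sub (summable_seqConv_term ha hb (z - 1))]
  refine tsum_congr fun x => ?_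
  rw [sub_right_comm, sub_mul]

lemma seqConv_comm (a b : ℤ → ℝ) : seqConv a b = seqConv b a := by
  funext z
  simp only [seqConv]
  rw [← (Equiv.subLeft z).tsum_eq]
  refine tsum_congr fun x => ?_
  simp [mul_comm]

lemma bdiff_seqConv_right {a b : ℤ → ℝ} (ha : Summable a) (hb : Summable b) :
    bdiff (seqConv a b) = seqConv a (bdiff b) := by
  rw [seqConv_comm, bdiff_seqConv_left hb ha, seqConv_comm]

lemma seqConv_comp_add_right (a b : ℤ → ℝ) (c z : ℤ) :
    seqConv a (fun x => b (x + c)) z = seqConv a b (z + c) := by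
  simp only [seqConv]
  rw [← (Equiv.addRight c).tsum_eq fun x => a (z + c - x) * b x]
  refine tsum_congr fun x => ?_
  simp

lemma seqConv_sub_right {a b c : ℤ → ℝ} (ha : Summable a) (hb : Summable b) (hc : Summable c) :
    seqConv a (fun x => b x - c x) = fun z => seqConv a b z - seqConv a c z := by
  funext z
  simp only [seqConv]
  rw [← (summable_seqConv_term ha hb z).tsum_sub (summable_seqConv_term ha hc z)]
  exact tsum_congr fun x => mul_sub _ _ _

lemma seqConv_neg_right (a b : ℤ → ℝ) :
    seqConv a (fun x => - b x) = fun z => - seqConv a b z := by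
  funext z
  simp [seqConv, tsum_neg]

lemma seqConv_single (a : ℤ → ℝ) : seqConv a (Pi.single 0 1) = a := by
  funext z
  simp only [seqConv]
  rw [tsum_eq_single 0] <;> simp +contextual

/-! ### Mass functions of distributions on `ℤ`. -/

lemma integrable_of_bound {μ : Measure ℤ} [IsFiniteMeasure μ] {f : ℤ → ℝ} {C : ℝ}
    (hf : ∀ x, |f x| ≤ C) : Integrable f μ :=
  Integrable.of_bound (measurable_of_countable f).aestronglyMeasurable C (ae_of_all _ hf)

lemma hasSum_massFun_mul {μ : Measure ℤ} [IsFiniteMeasure μ] {f : ℤ → ℝ} {C : ℝ}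
    (hf : ∀ x, |f x| ≤ C) : HasSum (fun x => massFun μ x * f x) (∫ x, f x ∂μ) := by
  have hi : Integrable f μ := integrable_of_bound hf
  have h := hasSum_integral_iUnion (μ := μ) (f := f) (s := fun x : ℤ => {x})
    (fun x => measurableSet_singleton x) (fun x y hxy => by simpa [Function.onFun] using hxy)
    (by rw [Set.iUnion_of_singleton]; exact hi.integrableOn)
  rw [Set.iUnion_of_singleton, setIntegral_univ] at h
  simpa [massFun, Measure.real] using h

lemma hasSum_massFun_indicator (μ : Measure ℤ) [IsFiniteMeasure μ] (A : Set ℤ) :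
    HasSum (A.indicator (massFun μ)) (μ.real A) := by
  have h := hasSum_massFun_mul (μ := μ) (f := A.indicator 1) (C := 1) fun x => by
    by_cases hx : x ∈ A <;> simp [hx]
  rw [integral_indicator_one A.to_countable.measurableSet] at h
  convert h using 2 with x
  by_cases hx : x ∈ A <;> simp [hx]

lemma summable_massFun (μ : Measure ℤ) [IsFiniteMeasure μ] : Summable (massFun μ) := by
  simpa using (hasSum_massFun_indicator μ Set.univ).summable

lemma tsum_massFun (μ : Measure ℤ) [IsProbabilityMeasure μ] : ∑' z, massFun μ z = 1 := by
  simpa using (hasSum_massFun_indicator μ Set.univ).tsum_eq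

lemma massFun_nonneg (μ : Measure ℤ) (z : ℤ) : 0 ≤ massFun μ z := measureReal_nonneg

lemma massFun_conv (μ ν : Measure ℤ) [IsFiniteMeasure μ] [IsFiniteMeasure ν] :
    massFun (μ.conv ν) = seqConv (massFun μ) (massFun ν) := by
  funext z
  rw [Measure.conv_comm]
  have h0 : ∀ A : Set ℤ, ∀ x, |A.indicator (1 : ℤ → ℝ) x| ≤ 1 := fun A x => by
    by_cases hx : x ∈ A <;> simp [hx]
  have h1 : massFun (ν.conv μ) z = ∫ x, ∫ y, ({z} : Set ℤ).indicator 1 (x + y) ∂μ ∂ν := by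
    rw [← integral_conv (integrable_of_bound (h0 _)),
      integral_indicator_one (measurableSet_singleton z), massFun]
  have h2 : ∀ x, ∫ y, ({z} : Set ℤ).indicator (1 : ℤ → ℝ) (x + y) ∂μ = massFun μ (z - x) := by
    intro x
    have : (fun y => ({z} : Set ℤ).indicator (1 : ℤ → ℝ) (x + y))
        = ({z - x} : Set ℤ).indicator 1 := by
      funext y
      simp only [Set.indicator, Set.mem_singleton_iff, Pi.one_apply]
      congr 1
      simp only [eq_iff_iff]
      omega
    rw [this, integral_indicator_one (measurableSet_singleton _), massFun]
  simp_rw [h1, h2]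
  have h3 := (hasSum_massFun_mul (μ := ν) (f := fun x => massFun μ (z - x)) (C := μ.real Set.univ)
    fun x => by
      rw [abs_of_nonneg (massFun_nonneg _ _)]
      exact measureReal_mono (Set.subset_univ _)).tsum_eq
  rw [← h3]
  simp only [seqConv, mul_comm]

lemma abs_real_sub_real_le (μ ν : Measure ℤ) [IsProbabilityMeasure μ] [IsProbabilityMeasure ν]
    (A : Set ℤ) :
    |μ.real A - ν.real A| ≤ l1Norm (fun z => massFun μ z - massFun ν z) / 2 := by
  have h : ∀ B : Set ℤ, HasSum (B.indicator fun z => massFun μ z - massFun ν z)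
      (μ.real B - ν.real B) := fun B => by
    have := (hasSum_massFun_indicator μ B).sub (hasSum_massFun_indicator ν B)
    rwa [← Set.indicator_sub] at this
  have hle : ∀ B : Set ℤ, |μ.real B - ν.real B| ≤
      ∑' z, |B.indicator (fun z => massFun μ z - massFun ν z) z| := fun B => by
    rw [← (h B).tsum_eq]
    exact norm_tsum_le_tsum_norm (h B).summable.norm
  -- Both masses are one, so `A` and its complement carry opposite differences. Each is bounded by
  -- its own share of the `ℓ¹` norm, which yields the factor `1/2`.
  have hc : μ.real Aᶜ - ν.real Aᶜ = - (μ.real A - ν.real A) := by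
    rw [probReal_compl_eq_one_sub A.to_countable.measurableSet,
      probReal_compl_eq_one_sub A.to_countable.measurableSet]
    ring
  have h1 := hle A
  have h2 := hle Aᶜ
  rw [hc, abs_neg] at h2
  have h3 : l1Norm (fun z => massFun μ z - massFun ν z)
      = ∑' z, |A.indicator (fun z => massFun μ z - massFun ν z) z|
        + ∑' z, |Aᶜ.indicator (fun z => massFun μ z - massFun ν z) z| := by
    rw [← (h A).summable.abs.tsum_add (h Aᶜ).summable.abs]
    refine tsum_congr fun z => ?_
    by_cases hz : z ∈ A <;> simp [hz]
  linarith

/-! ### Tail sums of distribution functions and smoothing. -/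

/-- The function whose `ℓ¹` norm is `zeta2 μ ν`. -/
noncomputable def cdfDiffTail (μ ν : Measure ℤ) : ℤ → ℝ := fun k =>
  ∑' u : Set.Ici k, (μ.real (Set.Iic (u : ℤ)) - ν.real (Set.Iic (u : ℤ)))

lemma real_Iic_sub (μ : Measure ℤ) [IsFiniteMeasure μ] (x : ℤ) :
    μ.real (Set.Iic x) - μ.real (Set.Iic (x - 1)) = massFun μ x := by
  have : Set.Iic x = Set.Iic (x - 1) ∪ {x} := by
    ext y; simp only [Set.mem_Iic, Set.mem_union, Set.mem_singleton_iff]; omega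
  rw [this, measureReal_union (by simp) (measurableSet_singleton x), massFun]
  ring

/-- Summability is needed because a divergent `tsum` takes the default value `0`. -/
lemma cdfDiffTail_sub {μ ν : Measure ℤ} {x : ℤ}
    (hs : Summable fun u : Set.Ici x => μ.real (Set.Iic (u : ℤ)) - ν.real (Set.Iic (u : ℤ))) :
    cdfDiffTail μ ν x - cdfDiffTail μ ν (x + 1) = μ.real (Set.Iic x) - ν.real (Set.Iic x) := by
  set g : ℤ → ℝ := fun u => μ.real (Set.Iic u) - ν.real (Set.Iic u) with hg
  have hs' : Summable ((Set.Ici x).indicator g) := summable_subtype_iff_indicator.mp hs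
  have hx : (Set.Ici x).indicator g = fun u => (Set.Ici (x + 1)).indicator g u
      + ({x} : Set ℤ).indicator g u := by
    funext u
    simp only [Set.indicator, Set.mem_Ici, Set.mem_singleton_iff]
    split_ifs <;> first | omega | simp
  have hs2 : Summable (({x} : Set ℤ).indicator g) :=
    summable_of_hasFiniteSupport ((Set.finite_singleton x).subset Set.support_indicator_subset)
  have hs1 : Summable ((Set.Ici (x + 1)).indicator g) := by
    have := hs'.sub hs2
    rw [hx] at this
    simpa using this
  have h1 : cdfDiffTail μ ν x = ∑' u, (Set.Ici x).indicator g u := tsum_subtype _ g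
  have h2 : cdfDiffTail μ ν (x + 1) = ∑' u, (Set.Ici (x + 1)).indicator g u := tsum_subtype _ g
  have h3 : ∑' u, ({x} : Set ℤ).indicator g u = g x := by
    rw [← tsum_subtype, tsum_singleton]
  rw [h1, h2, hx, hs1.tsum_add hs2, h3]
  ring

/-- Summation by parts: smoothing by `ρ` bounds a difference of two measures by `zeta2`. -/
lemma abs_conv_real_sub_le_zeta2 (ρ μ ν : Measure ℤ) [IsProbabilityMeasure ρ]
    [IsProbabilityMeasure μ] [IsProbabilityMeasure ν]
    (hs : ∀ x : ℤ,
      Summable fun u : Set.Ici x => μ.real (Set.Iic (u : ℤ)) - ν.real (Set.Iic (u : ℤ)))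
    (hH : Summable (cdfDiffTail μ ν)) (A : Set ℤ) :
    |(ρ.conv μ).real A - (ρ.conv ν).real A|
      ≤ l1Norm (bdiff (bdiff (massFun ρ))) * zeta2 μ ν / 2 := by
  have hρ := summable_massFun ρ
  refine (abs_real_sub_real_le _ _ A).trans ?_
  -- One difference of the tail sums gives the distribution functions, a second the masses. The
  -- shift by one arises because the tails run forward while `bdiff` looks back.
  have hD : (fun x => massFun μ x - massFun ν x)
      = fun x => - bdiff (bdiff (cdfDiffTail μ ν)) (x + 1) := by
    funext x
    have h1 := cdfDiffTail_sub (hs x)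
    have h2 := cdfDiffTail_sub (hs (x - 1))
    have h3 := real_Iic_sub μ x
    have h4 := real_Iic_sub ν x
    simp only [bdiff]
    simp only [sub_add_cancel, add_sub_cancel_right] at h2 ⊢
    linarith
  -- Differences commute with convolution, so both move from the tail sums onto `ρ`.
  have hc : (fun z => massFun (ρ.conv μ) z - massFun (ρ.conv ν) z)
      = fun z => - seqConv (bdiff (bdiff (massFun ρ))) (cdfDiffTail μ ν) (z + 1) := by
    simp only [massFun_conv]
    rw [← seqConv_sub_right hρ (summable_massFun μ) (summable_massFun ν), hD,
      seqConv_neg_right]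
    funext z
    rw [seqConv_comp_add_right, ← bdiff_seqConv_right hρ (summable_bdiff hH),
      ← bdiff_seqConv_right hρ hH, bdiff_seqConv_left hρ hH,
      bdiff_seqConv_left (summable_bdiff hρ) hH]
  rw [hc, l1Norm_neg fun z => seqConv (bdiff (bdiff (massFun ρ))) (cdfDiffTail μ ν) (z + 1),
    l1Norm_comp_add]
  have := l1Norm_seqConv_le (summable_bdiff (summable_bdiff hρ)) hH
  have hz : zeta2 μ ν = l1Norm (cdfDiffTail μ ν) := rfl
  rw [hz]
  linarith

/-- Convolution with a measure that has an atom of mass at least `c` at `0` shrinks the norm of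
second differences at most by the factor `1 - 2 (1 - c)`. -/
lemma l1Norm_bdiff_bdiff_le_conv (ρ β : Measure ℤ) [IsProbabilityMeasure ρ]
    [IsProbabilityMeasure β] {c : ℝ} (hc : c ≤ β.real {0}) :
    l1Norm (bdiff (bdiff (massFun ρ))) * (1 - 2 * (1 - c))
      ≤ l1Norm (bdiff (bdiff (massFun (ρ.conv β)))) := by
  have hρ := summable_massFun ρ
  have hβ := summable_massFun β
  have hd : Summable (Pi.single 0 1 : ℤ → ℝ) :=
    (hasSum_pi_single (0 : ℤ) (1 : ℝ)).summable
  set a := bdiff (bdiff (massFun ρ)) with ha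
  have has : Summable a := summable_bdiff (summable_bdiff hρ)
  have h1 : bdiff (bdiff (massFun (ρ.conv β))) = seqConv a (massFun β) := by
    rw [massFun_conv, bdiff_seqConv_left hρ hβ, bdiff_seqConv_left (summable_bdiff hρ) hβ]
  -- Perturbation of the identity: `a` is `a * β` minus `a * (β - δ₀)`, and the last term is small
  -- when `β` is close to `δ₀`.
  set e : ℤ → ℝ := fun x => massFun β x - (Pi.single 0 1 : ℤ → ℝ) x with he
  have hes : Summable e := hβ.sub hd
  have h2 : seqConv a e = fun z => seqConv a (massFun β) z - a z := by
    rw [he, seqConv_sub_right has hβ hd, seqConv_single]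
  have h3 : l1Norm a ≤ l1Norm (seqConv a (massFun β)) + l1Norm (seqConv a e) := by
    have hs1 := (summable_seqConv has hβ).abs
    have hs2 := (summable_seqConv has hes).abs
    simp only [l1Norm]
    rw [← hs1.tsum_add hs2]
    refine has.abs.tsum_le_tsum (fun z => ?_) (hs1.add hs2)
    rw [h2]
    have := abs_sub (seqConv a (massFun β) z) (seqConv a (massFun β) z - a z)
    rwa [sub_sub_cancel] at this
  -- The deficit `1 - β{0}` counts once at `0` and once more as the mass outside `0`.
  have h4 : l1Norm e = 2 * (1 - β.real {0}) := by
    have h5 : ∀ x, |e x| = massFun β x + (Pi.single 0 (1 - 2 * β.real {0}) : ℤ → ℝ) x := by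
      intro x
      by_cases hx : x = 0
      · subst hx
        have : β.real {0} ≤ 1 := measureReal_le_one
        simp only [he, Pi.single_eq_same, massFun]
        rw [abs_of_nonpos (by linarith)]
        ring
      · simp [he, hx, abs_of_nonneg (massFun_nonneg β x)]
    have h6 := hasSum_pi_single (0 : ℤ) (1 - 2 * β.real {0})
    simp only [l1Norm]
    rw [tsum_congr h5, hβ.tsum_add h6.summable, tsum_massFun, h6.tsum_eq]
    ring
  have h5 := l1Norm_seqConv_le has hes
  rw [h4] at h5
  rw [h1]
  have h6 : l1Norm a * (2 * (1 - β.real {0})) ≤ l1Norm a * (2 * (1 - c)) :=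
    mul_le_mul_of_nonneg_left (by linarith) (l1Norm_nonneg a)
  linarith

/-! ### Convergence of the sums defining `zeta2`. -/

section CdfDiffTail

/-- For fixed `x`, the pairs of naturals with sum below `x` lie in the square `[0, x)²`, which has
at most `x²` points. This is where second moments control the double tail sum. -/
lemma tsum_measure_Ioi_add_le (μ : Measure ℤ) :
    ∑' p : ℕ × ℕ, μ (Set.Ioi ((p.1 : ℤ) + p.2)) ≤ ∫⁻ x, ENNReal.ofReal ((x : ℝ) ^ 2) ∂μ := by
  have h1 : ∀ p : ℕ × ℕ, μ (Set.Ioi ((p.1 : ℤ) + p.2))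
      = ∫⁻ x, (Set.Ioi ((p.1 : ℤ) + p.2)).indicator 1 x ∂μ := fun p => by
    rw [lintegral_indicator_one measurableSet_Ioi]
  simp_rw [h1]
  rw [← lintegral_tsum fun p => (measurable_of_countable _).aemeasurable]
  refine lintegral_mono fun x => ?_
  have h2 : ∀ p : ℕ × ℕ, (Set.Ioi ((p.1 : ℤ) + p.2)).indicator (1 : ℤ → ENNReal) x
      ≤ ((Finset.range x.toNat ×ˢ Finset.range x.toNat : Finset (ℕ × ℕ)) :
          Set (ℕ × ℕ)).indicator 1 p := fun p => by
    simp only [Set.indicator, Set.mem_Ioi, Finset.coe_product, Finset.coe_range, Set.mem_prod,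
      Set.mem_Iio, Pi.one_apply]
    split_ifs
    · exact le_rfl
    · omega
    · exact zero_le_one
    · exact le_rfl
  refine (ENNReal.tsum_le_tsum h2).trans ?_
  rw [← tsum_subtype, Finset.tsum_subtype']
  simp only [Pi.one_apply, Finset.sum_const, Finset.card_product, Finset.card_range, nsmul_eq_mul,
    mul_one]
  rw [ENNReal.le_ofReal_iff_toReal_le (by finiteness) (by positivity)]
  rcases le_total 0 x with hx | hx
  · lift x to ℕ using hx
    simp [sq]
  · simp [Int.toNat_of_nonpos hx]; positivity

lemma tsum_measure_Ioi (μ : Measure ℤ) :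
    ∑' u : ℕ, μ (Set.Ioi (u : ℤ)) = ∫⁻ x, ENNReal.ofReal (x : ℝ) ∂μ := by
  have h1 : ∀ u : ℕ, μ (Set.Ioi (u : ℤ))
      = ∫⁻ x, (Set.Ioi (u : ℤ)).indicator 1 x ∂μ := fun p => by
    rw [lintegral_indicator_one measurableSet_Ioi]
  simp_rw [h1]
  rw [← lintegral_tsum fun p => (measurable_of_countable _).aemeasurable]
  refine lintegral_congr fun x => ?_
  have h2 : ∀ u : ℕ, (Set.Ioi (u : ℤ)).indicator (1 : ℤ → ENNReal) x
      = (Finset.range x.toNat : Set ℕ).indicator 1 u := fun u => by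
    simp only [Set.indicator, Set.mem_Ioi, Finset.coe_range, Set.mem_Iio, Pi.one_apply]
    congr 1
    simp only [eq_iff_iff]
    omega
  rw [tsum_congr h2, ← tsum_subtype, Finset.tsum_subtype']
  simp only [Pi.one_apply, Finset.sum_const, Finset.card_range, nsmul_eq_mul, mul_one]
  rcases le_total 0 x with hx | hx
  · lift x to ℕ using hx
    simp
  · rw [Int.toNat_of_nonpos hx, ENNReal.ofReal_of_nonpos (by exact_mod_cast hx)]
    simp

lemma real_Iic_eq (μ : Measure ℤ) [IsProbabilityMeasure μ] (x : ℤ) :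
    μ.real (Set.Iic x) = 1 - μ.real (Set.Ioi x) := by
  rw [← Set.compl_Ioi, probReal_compl_eq_one_sub measurableSet_Ioi]

lemma summable_real_Ioi_add {μ : Measure ℤ} (h : Integrable (fun x : ℤ => (x : ℝ) ^ 2) μ) :
    Summable fun p : ℕ × ℕ => μ.real (Set.Ioi ((p.1 : ℤ) + p.2)) := by
  refine ENNReal.summable_toReal (ne_top_of_le_ne_top ?_ (tsum_measure_Ioi_add_le μ))
  rw [← ofReal_integral_eq_lintegral_ofReal h (ae_of_all _ fun x => by positivity)]
  exact ENNReal.ofReal_ne_top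

lemma integrable_cast_of_sq {μ : Measure ℤ} (h : Integrable (fun x : ℤ => (x : ℝ) ^ 2) μ) :
    Integrable (fun x : ℤ => (x : ℝ)) μ := by
  refine h.mono' (measurable_of_countable _).aestronglyMeasurable (ae_of_all _ fun x => ?_)
  rw [Real.norm_eq_abs]
  exact_mod_cast (Int.natAbs_le_self_sq x).trans' (by simp)

variable {μ ν : Measure ℤ} [IsProbabilityMeasure μ] [IsProbabilityMeasure ν]

lemma hasSum_real_Ioi (h0 : μ (Set.Iio 0) = 0)
    (h : Integrable (fun x : ℤ => (x : ℝ) ^ 2) μ) :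
    HasSum (fun u : ℕ => μ.real (Set.Ioi (u : ℤ))) (∫ x : ℤ, (x : ℝ) ∂μ) := by
  have hi := integrable_cast_of_sq h
  have hnn : 0 ≤ᵐ[μ] fun x : ℤ => (x : ℝ) := by
    rw [Filter.EventuallyLE, ae_iff]
    convert h0 using 2
    ext x
    simp
  have h1 := tsum_measure_Ioi μ
  rw [integral_eq_lintegral_of_nonneg_ae hnn hi.aestronglyMeasurable, ← h1]
  rw [ENNReal.tsum_toReal_eq fun _ => measure_ne_top _ _]
  refine ENNReal.hasSum_toReal ?_
  rw [h1, ← ofReal_integral_eq_lintegral_ofReal hi hnn]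
  exact ENNReal.ofReal_ne_top

lemma real_Iic_of_neg (h0 : μ (Set.Iio 0) = 0) {x : ℤ} (hx : x < 0) :
    μ.real (Set.Iic x) = 0 :=
  (measureReal_eq_zero_iff).mpr (measure_mono_null (fun y hy => lt_of_le_of_lt hy hx) h0)

lemma summable_cdf_sub (hμ0 : μ (Set.Iio 0) = 0) (hν0 : ν (Set.Iio 0) = 0)
    (hμ : Integrable (fun x : ℤ => (x : ℝ) ^ 2) μ)
    (hν : Integrable (fun x : ℤ => (x : ℝ) ^ 2) ν) :
    Summable fun u : ℤ => μ.real (Set.Iic u) - ν.real (Set.Iic u) := by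
  have hinj : Function.Injective (fun u : ℕ => (u : ℤ)) := Nat.cast_injective
  rw [← hinj.summable_iff]
  · have := (hasSum_real_Ioi hν0 hν).summable.sub (hasSum_real_Ioi hμ0 hμ).summable
    refine this.congr fun u => ?_
    simp only [Function.comp, real_Iic_eq]
    ring
  · intro x hx
    have hx' : x < 0 := by
      by_contra hge
      exact hx ⟨x.toNat, by simp; omega⟩
    rw [real_Iic_of_neg hμ0 hx', real_Iic_of_neg hν0 hx', sub_zero]

lemma cdfDiffTail_natCast (μ ν : Measure ℤ) [IsProbabilityMeasure μ] [IsProbabilityMeasure ν]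
    (r : ℕ) :
    cdfDiffTail μ ν r
      = ∑' j : ℕ, (ν.real (Set.Ioi ((r : ℤ) + j)) - μ.real (Set.Ioi ((r : ℤ) + j))) := by
  let e : ℕ ≃ Set.Ici (r : ℤ) :=
    { toFun := fun j => ⟨r + j, by simp⟩
      invFun := fun u => (u.1 - (r : ℤ)).toNat
      left_inv := fun j => by simp
      right_inv := fun u => by
        have := u.2
        rw [Set.mem_Ici] at this
        ext
        simp only
        omega }
  rw [cdfDiffTail, ← e.tsum_eq]
  refine tsum_congr fun j => ?_
  change μ.real (Set.Iic ((r : ℤ) + j)) - ν.real (Set.Iic ((r : ℤ) + j)) = _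
  rw [real_Iic_eq, real_Iic_eq]
  ring

/-- At `0` the tail sum is the difference of the means. Below `0` both distribution functions
vanish, so the tail sum no longer changes. -/
lemma cdfDiffTail_of_nonpos (hμ0 : μ (Set.Iio 0) = 0) (hν0 : ν (Set.Iio 0) = 0)
    (hμ : Integrable (fun x : ℤ => (x : ℝ) ^ 2) μ)
    (hν : Integrable (fun x : ℤ => (x : ℝ) ^ 2) ν)
    (hmean : ∫ x : ℤ, (x : ℝ) ∂μ = ∫ x : ℤ, (x : ℝ) ∂ν) (m : ℕ) :
    cdfDiffTail μ ν (-m) = 0 := by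
  have hs := summable_cdf_sub hμ0 hν0 hμ hν
  induction m with
  | zero =>
    have h1 := ((hasSum_real_Ioi hν0 hν).sub (hasSum_real_Ioi hμ0 hμ)).tsum_eq
    have h2 := cdfDiffTail_natCast μ ν 0
    simp only [Nat.cast_zero, zero_add] at h2
    simp only [Nat.cast_zero, neg_zero]
    rw [h2, h1, hmean, sub_self]
  | succ m ih =>
    have h1 := cdfDiffTail_sub (μ := μ) (ν := ν) (x := -(m + 1 : ℕ)) (hs.subtype _)
    have h2 : (-((m + 1 : ℕ) : ℤ) + 1) = -m := by push_cast; ring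
    have h3 : (-((m + 1 : ℕ) : ℤ)) < 0 := by omega
    rw [h2, ih, real_Iic_of_neg hμ0 h3, real_Iic_of_neg hν0 h3] at h1
    simpa using h1

lemma summable_cdfDiffTail (hμ0 : μ (Set.Iio 0) = 0) (hν0 : ν (Set.Iio 0) = 0)
    (hμ : Integrable (fun x : ℤ => (x : ℝ) ^ 2) μ)
    (hν : Integrable (fun x : ℤ => (x : ℝ) ^ 2) ν)
    (hmean : ∫ x : ℤ, (x : ℝ) ∂μ = ∫ x : ℤ, (x : ℝ) ∂ν) :
    Summable (cdfDiffTail μ ν) := by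
  have hinj : Function.Injective (fun u : ℕ => (u : ℤ)) := Nat.cast_injective
  rw [← hinj.summable_iff]
  · have := ((summable_real_Ioi_add hν).sub (summable_real_Ioi_add hμ)).prod
    exact this.congr fun r => (cdfDiffTail_natCast μ ν r).symm
  · intro x hx
    have hx' : x < 0 := by
      by_contra hge
      exact hx ⟨x.toNat, by simp; omega⟩
    have := cdfDiffTail_of_nonpos hμ0 hν0 hμ hν hmean x.natAbs
    convert this using 2
    omega

end CdfDiffTail

/-! ### Compound Poisson distributions: mixture weights, characteristic functions, moments. -/

lemma hasSum_poisson_weight_mul_pow (l x : ℝ) :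
    HasSum (fun j : ℕ => Real.exp (-l) * l ^ j / (j.factorial : ℝ) * x ^ j)
      (Real.exp (l * x - l)) := by
  have h := (NormedSpace.expSeries_div_hasSum_exp (l * x)).mul_left (Real.exp (-l))
  rw [← Real.exp_eq_exp_ℝ, ← Real.exp_add] at h
  convert! h using 1
  · funext j
    rw [mul_pow]
    ring
  · congr 1
    ring

lemma hasSum_poisson_weight_mul_cpow (l : ℝ) (x : ℂ) :
    HasSum (fun j : ℕ => ((Real.exp (-l) * l ^ j / (j.factorial : ℝ) : ℝ) : ℂ) * x ^ j)
      (Complex.exp (l * x - l)) := by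
  have h := (NormedSpace.expSeries_div_hasSum_exp (l * x)).mul_left (Complex.exp (-l))
  rw [← Complex.exp_eq_exp_ℂ, ← Complex.exp_add] at h
  convert! h using 1
  · funext j
    rw [mul_pow]
    push_cast
    ring
  · congr 1
    ring

lemma hasSum_poisson_weight (l : ℝ) :
    HasSum (fun j : ℕ => Real.exp (-l) * l ^ j / (j.factorial : ℝ)) 1 := by
  simpa using hasSum_poisson_weight_mul_pow l 1

lemma hasSum_poisson_weight_mul_id (l : ℝ) :
    HasSum (fun j : ℕ => Real.exp (-l) * l ^ j / (j.factorial : ℝ) * j) l := by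
  rw [← hasSum_nat_add_iff' 1]
  have h := (hasSum_poisson_weight l).mul_left l
  convert! h using 1
  · funext j
    rw [Nat.factorial_succ]
    have : (j.factorial : ℝ) ≠ 0 := by positivity
    push_cast
    field_simp
    ring
  · simp

lemma poisson_weight_nonneg {l : ℝ} (hl : 0 ≤ l) (j : ℕ) :
    0 ≤ Real.exp (-l) * l ^ j / (j.factorial : ℝ) := by positivity

instance isFiniteMeasure_convPower (F : Measure ℤ) [IsFiniteMeasure F] (j : ℕ) :
    IsFiniteMeasure (convPower F j) := by
  induction j with
  | zero => exact inferInstanceAs (IsFiniteMeasure (Measure.dirac (0 : ℤ)))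
  | succ j ih => exact inferInstanceAs (IsFiniteMeasure ((convPower F j).conv F))

/-- Mass at most one, rather than exactly one, is assumed because `condLawNeZero` is the zero
measure when `p_i = 0`. -/
lemma convPower_univ_le (F : Measure ℤ) [IsFiniteMeasure F] (hF : F Set.univ ≤ 1) (j : ℕ) :
    convPower F j Set.univ ≤ 1 := by
  induction j with
  | zero => simp [convPower]
  | succ j ih =>
    rw [convPower, Measure.conv, Measure.map_apply measurable_add MeasurableSet.univ,
      Set.preimage_univ, ← Set.univ_prod_univ, Measure.prod_prod]
    exact mul_le_one' ih hF

lemma convPower_one (F : Measure ℤ) [IsFiniteMeasure F] : convPower F 1 = F := by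
  simp [convPower]

lemma tsum_ofReal_poisson_weight {l : ℝ} (hl : 0 ≤ l) :
    ∑' j : ℕ, ENNReal.ofReal (Real.exp (-l) * l ^ j / (j.factorial : ℝ)) = 1 := by
  rw [← ENNReal.ofReal_tsum_of_nonneg (poisson_weight_nonneg hl) (hasSum_poisson_weight l).summable,
    (hasSum_poisson_weight l).tsum_eq, ENNReal.ofReal_one]

lemma isFiniteMeasure_compoundPoisson {l : ℝ} (hl : 0 ≤ l) (F : Measure ℤ) [IsFiniteMeasure F]
    (hF : F Set.univ ≤ 1) : IsFiniteMeasure (compoundPoisson l F) := by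
  refine ⟨lt_of_le_of_lt (b := (1 : ENNReal)) ?_ (by simp)⟩
  rw [compoundPoisson, Measure.sum_apply _ MeasurableSet.univ, ← tsum_ofReal_poisson_weight hl]
  refine ENNReal.tsum_le_tsum fun j => ?_
  rw [Measure.smul_apply, smul_eq_mul]
  exact mul_le_of_le_one_right' (convPower_univ_le F hF j)

lemma hasSum_integral_compoundPoisson {E : Type*} [NormedAddCommGroup E] [NormedSpace ℝ E]
    {l : ℝ} (hl : 0 ≤ l) (F : Measure ℤ) {f : ℤ → E} (hf : Integrable f (compoundPoisson l F)) :
    HasSum (fun j : ℕ => (Real.exp (-l) * l ^ j / (j.factorial : ℝ)) • ∫ x, f x ∂convPower F j)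
      (∫ x, f x ∂compoundPoisson l F) := by
  have h := hasSum_integral_measure hf
  refine h.congr_fun fun j => ?_
  rw [integral_smul_measure, ENNReal.toReal_ofReal (poisson_weight_nonneg hl j)]

/-- The characteristic function of a distribution on `ℤ`. -/
noncomputable def intCharFun (μ : Measure ℤ) (t : ℝ) : ℂ :=
  charFun (μ.map (fun x : ℤ => (x : ℝ))) t

lemma intCharFun_eq_integral (μ : Measure ℤ) (t : ℝ) :
    intCharFun μ t = ∫ x : ℤ, Complex.exp (t * x * Complex.I) ∂μ := by
  rw [intCharFun, charFun_apply_real, integral_map (by fun_prop) (by fun_prop)]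
  simp

/-- The embedding of `ℤ` in `ℝ` is measurable, so the measure is recovered from its image, which the
characteristic function determines. -/
lemma eq_of_intCharFun_eq {μ ν : Measure ℤ} [IsFiniteMeasure μ] [IsFiniteMeasure ν]
    (h : ∀ t, intCharFun μ t = intCharFun ν t) : μ = ν := by
  have he : MeasurableEmbedding (fun x : ℤ => (x : ℝ)) :=
    Int.isClosedEmbedding_coe_real.measurableEmbedding
  have h1 := Measure.ext_of_charFun (funext h)
  rw [← he.comap_map μ, h1, he.comap_map ν]

lemma intCharFun_conv (μ ν : Measure ℤ) [IsFiniteMeasure μ] [IsFiniteMeasure ν] (t : ℝ) :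
    intCharFun (μ.conv ν) t = intCharFun μ t * intCharFun ν t := by
  have h := Measure.map_conv_addMonoidHom (μ := μ) (ν := ν) (Int.castAddHom ℝ)
    (measurable_of_countable _)
  simp only [intCharFun]
  rw [← charFun_conv]
  exact congrArg (fun m => charFun m t) h

lemma intCharFun_dirac_zero (t : ℝ) : intCharFun (Measure.dirac 0) t = 1 := by
  simp [intCharFun_eq_integral]

lemma intCharFun_convPower (F : Measure ℤ) [IsFiniteMeasure F] (j : ℕ) (t : ℝ) :
    intCharFun (convPower F j) t = intCharFun F t ^ j := by
  induction j with
  | zero => rw [convPower, intCharFun_dirac_zero, pow_zero]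
  | succ j ih => rw [convPower, intCharFun_conv, ih, pow_succ]

lemma integrable_cexp (μ : Measure ℤ) [IsFiniteMeasure μ] (t : ℝ) :
    Integrable (fun x : ℤ => Complex.exp (t * x * Complex.I)) μ := by
  refine Integrable.of_bound (measurable_of_countable _).aestronglyMeasurable 1
    (ae_of_all _ fun x => ?_)
  have : (t * x * Complex.I : ℂ) = ((t * x : ℝ) : ℂ) * Complex.I := by push_cast; ring
  rw [this, Complex.norm_exp_ofReal_mul_I]

lemma intCharFun_compoundPoisson {l : ℝ} (hl : 0 ≤ l) (F : Measure ℤ) [IsFiniteMeasure F]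
    (hF : F Set.univ ≤ 1) (t : ℝ) :
    intCharFun (compoundPoisson l F) t = Complex.exp (l * intCharFun F t - l) := by
  have := isFiniteMeasure_compoundPoisson hl F hF
  have h := hasSum_integral_compoundPoisson hl F (integrable_cexp (compoundPoisson l F) t)
  rw [intCharFun_eq_integral, ← h.tsum_eq, ← (hasSum_poisson_weight_mul_cpow l _).tsum_eq]
  refine tsum_congr fun j => ?_
  rw [← intCharFun_eq_integral, intCharFun_convPower, Complex.real_smul]

lemma compoundPoisson_zero_left (F : Measure ℤ) : compoundPoisson 0 F = Measure.dirac 0 := by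
  ext A hA
  rw [compoundPoisson, Measure.sum_apply _ hA, tsum_eq_single 0]
  · simp [convPower]
  · intro j hj
    simp [hj]

lemma exp_neg_le_compoundPoisson_zero (l : ℝ) (F : Measure ℤ) :
    ENNReal.ofReal (Real.exp (-l)) ≤ compoundPoisson l F {0} := by
  rw [compoundPoisson, Measure.sum_apply _ (measurableSet_singleton 0)]
  refine le_trans (le_of_eq ?_) (ENNReal.le_tsum 0)
  simp [convPower]

lemma compoundPoisson_Iio_zero {l : ℝ} (F : Measure ℤ) [IsFiniteMeasure F]
    (hF : F (Set.Iio 0) = 0) : compoundPoisson l F (Set.Iio 0) = 0 := by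
  rw [compoundPoisson, Measure.sum_apply _ measurableSet_Iio, ENNReal.tsum_eq_zero]
  intro j
  rw [Measure.smul_apply, smul_eq_mul]
  refine mul_eq_zero_of_right _ ?_
  induction j with
  | zero => simp [convPower]
  | succ j ih =>
    rw [convPower, Measure.conv, Measure.map_apply measurable_add measurableSet_Iio]
    refine measure_mono_null (t := Set.Iio 0 ×ˢ Set.univ ∪ Set.univ ×ˢ Set.Iio 0) ?_ ?_
    · rintro ⟨x, y⟩ hxy
      simp only [Set.mem_preimage, Set.mem_Iio, Set.mem_union, Set.mem_prod, Set.mem_univ,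
        and_true, true_and] at hxy ⊢
      omega
    · rw [measure_union_null_iff, Measure.prod_prod, Measure.prod_prod, ih, hF]
      simp

/-- The second moment of a distribution on `ℤ`, as an extended nonnegative real. -/
noncomputable def secondMoment (μ : Measure ℤ) : ENNReal :=
  ∫⁻ x : ℤ, ENNReal.ofReal ((x : ℝ) ^ 2) ∂μ

lemma integrable_sq_iff (μ : Measure ℤ) :
    Integrable (fun x : ℤ => (x : ℝ) ^ 2) μ ↔ secondMoment μ ≠ ⊤ := by
  rw [secondMoment, ← lt_top_iff_ne_top, ← hasFiniteIntegral_iff_ofReal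
    (ae_of_all _ fun x : ℤ => by positivity)]
  exact ⟨fun h => h.2, fun h => ⟨(measurable_of_countable _).aestronglyMeasurable, h⟩⟩

/-- Crude induction with `(x + y)² ≤ 2x² + 2y²`; any geometric growth in `j` is summable against the
Poisson weights. -/
lemma secondMoment_convPower_le (F : Measure ℤ) [IsFiniteMeasure F] (hF : F Set.univ ≤ 1) (j : ℕ) :
    secondMoment (convPower F j) ≤ 4 ^ j * secondMoment F := by
  induction j with
  | zero => simp [convPower, secondMoment]
  | succ j ih =>
    have h1 : ∀ x y : ℤ, ENNReal.ofReal (((x + y : ℤ) : ℝ) ^ 2)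
        ≤ 2 * ENNReal.ofReal ((x : ℝ) ^ 2) + 2 * ENNReal.ofReal ((y : ℝ) ^ 2) := fun x y => by
      rw [← ENNReal.ofReal_ofNat, ← ENNReal.ofReal_mul (by norm_num),
        ← ENNReal.ofReal_mul (by norm_num), ← ENNReal.ofReal_add (by positivity) (by positivity)]
      refine ENNReal.ofReal_le_ofReal ?_
      push_cast
      nlinarith [sq_nonneg ((x : ℝ) - y)]
    have h2 : secondMoment (convPower F (j + 1))
        ≤ 2 * secondMoment (convPower F j) + 2 * secondMoment F := by
      rw [convPower, secondMoment, Measure.lintegral_conv (measurable_of_countable _)]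
      calc _ ≤ ∫⁻ x, ∫⁻ y, (2 * ENNReal.ofReal ((x : ℝ) ^ 2) + 2 * ENNReal.ofReal ((y : ℝ) ^ 2))
              ∂F ∂convPower F j := lintegral_mono fun x => lintegral_mono fun y => h1 x y
        _ = ∫⁻ x, (2 * ENNReal.ofReal ((x : ℝ) ^ 2) * F Set.univ + 2 * secondMoment F)
              ∂convPower F j := by
            refine lintegral_congr fun x => ?_
            rw [lintegral_add_left measurable_const, lintegral_const,
              lintegral_const_mul _ (measurable_of_countable _), secondMoment]
        _ ≤ ∫⁻ x, (2 * ENNReal.ofReal ((x : ℝ) ^ 2) + 2 * secondMoment F) ∂convPower F j := by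
            refine lintegral_mono fun x => ?_
            exact add_le_add (mul_le_of_le_one_right zero_le hF) le_rfl
        _ = 2 * secondMoment (convPower F j)
              + 2 * secondMoment F * convPower F j Set.univ := by
            rw [lintegral_add_right _ measurable_const, lintegral_const,
              lintegral_const_mul _ (measurable_of_countable _), ← secondMoment]
        _ ≤ _ := by
            exact add_le_add le_rfl (mul_le_of_le_one_right zero_le (convPower_univ_le F hF j))
    calc _ ≤ 2 * (4 ^ j * secondMoment F) + 2 * (4 ^ j * secondMoment F) := by
          refine h2.trans ?_
          gcongr
          exact le_mul_of_one_le_left' (one_le_pow₀ (by norm_num))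
      _ = _ := by ring

lemma secondMoment_compoundPoisson_ne_top {l : ℝ} (hl : 0 ≤ l) (F : Measure ℤ) [IsFiniteMeasure F]
    (hF : F Set.univ ≤ 1) (h : secondMoment F ≠ ⊤) : secondMoment (compoundPoisson l F) ≠ ⊤ := by
  rw [secondMoment, compoundPoisson, lintegral_sum_measure]
  have h1 : ∀ j : ℕ, ∫⁻ x : ℤ, ENNReal.ofReal ((x : ℝ) ^ 2)
      ∂(ENNReal.ofReal (Real.exp (-l) * l ^ j / (j.factorial : ℝ)) • convPower F j)
      ≤ ENNReal.ofReal (Real.exp (-l) * l ^ j / (j.factorial : ℝ) * 4 ^ j) * secondMoment F :=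
    fun j => by
      rw [lintegral_smul_measure, smul_eq_mul, ENNReal.ofReal_mul (poisson_weight_nonneg hl j),
        mul_assoc]
      gcongr
      refine (secondMoment_convPower_le F hF j).trans (le_of_eq ?_)
      rw [ENNReal.ofReal_pow (by norm_num), ENNReal.ofReal_ofNat]
  refine ne_top_of_le_ne_top ?_ (ENNReal.tsum_le_tsum h1)
  rw [ENNReal.tsum_mul_right]
  refine ENNReal.mul_ne_top ?_ h
  exact (hasSum_poisson_weight_mul_pow l 4).summable.tsum_ofReal_ne_top

/-- Means add under convolution only when both factors have mass one, so that property is carried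
through the induction. -/
lemma integral_cast_convPower (F : Measure ℤ) [IsProbabilityMeasure F]
    (h : secondMoment F ≠ ⊤) (j : ℕ) :
    IsProbabilityMeasure (convPower F j) ∧
      ∫ x : ℤ, (x : ℝ) ∂convPower F j = j * ∫ x : ℤ, (x : ℝ) ∂F := by
  have hi : ∀ j, Integrable (fun x : ℤ => (x : ℝ)) (convPower F j) := fun j => by
    refine integrable_cast_of_sq ((integrable_sq_iff _).mpr (ne_top_of_le_ne_top ?_
      (secondMoment_convPower_le F prob_le_one j)))
    exact ENNReal.mul_ne_top (by finiteness) h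
  induction j with
  | zero => exact ⟨inferInstanceAs (IsProbabilityMeasure (Measure.dirac (0 : ℤ))),
      by simp [convPower]⟩
  | succ j ih =>
    obtain ⟨ih1, ih2⟩ := ih
    refine ⟨inferInstanceAs (IsProbabilityMeasure ((convPower F j).conv F)), ?_⟩
    have hF : Integrable (fun x : ℤ => (x : ℝ)) F :=
      integrable_cast_of_sq ((integrable_sq_iff _).mpr h)
    have h3 := hi (j + 1)
    rw [convPower] at h3 ⊢
    rw [integral_conv h3]
    have h4 : ∀ x : ℤ, ∫ y : ℤ, ((x + y : ℤ) : ℝ) ∂F = x + ∫ y : ℤ, (y : ℝ) ∂F := fun x => by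
      push_cast
      rw [integral_add (integrable_const _) hF]
      simp
    simp_rw [h4]
    rw [integral_add (hi j) (integrable_const _), ih2]
    simp
    ring

lemma integral_cast_compoundPoisson {l : ℝ} (hl : 0 ≤ l) (F : Measure ℤ) [IsProbabilityMeasure F]
    (h : secondMoment F ≠ ⊤) :
    ∫ x : ℤ, (x : ℝ) ∂compoundPoisson l F = l * ∫ x : ℤ, (x : ℝ) ∂F := by
  have hi : Integrable (fun x : ℤ => (x : ℝ)) (compoundPoisson l F) :=
    integrable_cast_of_sq ((integrable_sq_iff _).mpr
      (secondMoment_compoundPoisson_ne_top hl F prob_le_one h))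
  rw [← (hasSum_integral_compoundPoisson hl F hi).tsum_eq,
    ← ((hasSum_poisson_weight_mul_id l).mul_right _).tsum_eq]
  refine tsum_congr fun j => ?_
  rw [(integral_cast_convPower F h j).2, smul_eq_mul]
  ring

/-! ### Total variation distance and integrals of bounded functions. -/

lemma bddAbove_tvDist (μ ν : Measure ℤ) [IsProbabilityMeasure μ] [IsProbabilityMeasure ν] :
    BddAbove (Set.range fun A : Set ℤ => |μ.real A - ν.real A|) := by
  refine ⟨1, ?_⟩
  rintro _ ⟨A, rfl⟩
  have h1 : μ.real A ≤ 1 := measureReal_le_one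
  have h2 : ν.real A ≤ 1 := measureReal_le_one
  have h3 : 0 ≤ μ.real A := measureReal_nonneg
  have h4 : 0 ≤ ν.real A := measureReal_nonneg
  exact abs_le.mpr ⟨by linarith, by linarith⟩

lemma abs_real_sub_le_tvDist (μ ν : Measure ℤ) [IsProbabilityMeasure μ] [IsProbabilityMeasure ν]
    (A : Set ℤ) : |μ.real A - ν.real A| ≤ tvDist μ ν :=
  le_ciSup (bddAbove_tvDist μ ν) A

lemma l1Norm_massFun_sub_le (μ ν : Measure ℤ) [IsProbabilityMeasure μ] [IsProbabilityMeasure ν] :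
    l1Norm (fun z => massFun μ z - massFun ν z) ≤ 2 * tvDist μ ν := by
  set d : ℤ → ℝ := fun z => massFun μ z - massFun ν z with hd
  -- The extremal set: since `d` sums to `0` and `|d| = 2 · 1_A d - d`, the norm is twice the
  -- difference on `A`.
  set A : Set ℤ := {z | 0 ≤ d z} with hA
  have h : HasSum (A.indicator d) (μ.real A - ν.real A) := by
    have := (hasSum_massFun_indicator μ A).sub (hasSum_massFun_indicator ν A)
    rwa [← Set.indicator_sub] at this
  have hsum : HasSum d 0 := by
    have h1 := (summable_massFun μ).hasSum.sub (summable_massFun ν).hasSum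
    rwa [tsum_massFun, tsum_massFun, sub_self] at h1
  have h2 : ∀ z, |d z| = 2 * A.indicator d z - d z := fun z => by
    by_cases hz : 0 ≤ d z
    · rw [Set.indicator_of_mem (show z ∈ A from hz), abs_of_nonneg hz]
      ring
    · rw [Set.indicator_of_notMem (show z ∉ A from hz), abs_of_neg (not_le.mp hz)]
      ring
  have h3 := ((h.mul_left 2).sub hsum).tsum_eq
  rw [l1Norm, tsum_congr h2, h3]
  have := (le_abs_self _).trans (abs_real_sub_le_tvDist μ ν A)
  linarith

lemma abs_integral_sub_le_tvDist (μ ν : Measure ℤ) [IsProbabilityMeasure μ]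
    [IsProbabilityMeasure ν] {h : ℤ → ℝ} {β : ℝ} (hh : ∀ x, |h x| ≤ β) :
    |∫ x, h x ∂μ - ∫ x, h x ∂ν| ≤ 2 * tvDist μ ν * β := by
  have hs := (hasSum_massFun_mul (μ := μ) hh).sub (hasSum_massFun_mul (μ := ν) hh)
  have hβ : 0 ≤ β := (abs_nonneg _).trans (hh 0)
  have hd := ((summable_massFun μ).sub (summable_massFun ν)).abs
  rw [← hs.tsum_eq]
  have h1 : ∀ x, |massFun μ x * h x - massFun ν x * h x|
      ≤ |massFun μ x - massFun ν x| * β := fun x => by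
    rw [← sub_mul, abs_mul]
    gcongr
    exact hh x
  calc _ ≤ ∑' x, |massFun μ x * h x - massFun ν x * h x| :=
        norm_tsum_le_tsum_norm hs.summable.norm
    _ ≤ ∑' x, |massFun μ x - massFun ν x| * β :=
        hs.summable.abs.tsum_le_tsum h1 (hd.mul_right β)
    _ = l1Norm (fun z => massFun μ z - massFun ν z) * β := by rw [tsum_mul_right, l1Norm]
    _ ≤ _ := by
        gcongr
        exact l1Norm_massFun_sub_le μ ν

/-! ### A single variable: its law split at `0`, compared with `CP(p, G)`. -/

section Law

variable {Ω : Type*} [MeasurableSpace Ω] (P : Measure Ω)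

lemma measurableSet_ne_zero {Y : Ω → ℤ} (hY : Measurable Y) : MeasurableSet {ω | Y ω ≠ 0} :=
  hY (measurableSet_singleton (0 : ℤ)).compl

lemma probNeZero_nonneg (Y : Ω → ℤ) : 0 ≤ probNeZero P Y := measureReal_nonneg

lemma condLawNeZero_univ_le {Y : Ω → ℤ} (hY : Measurable Y) :
    condLawNeZero P Y Set.univ ≤ 1 := by
  rw [condLawNeZero, Measure.map_apply hY MeasurableSet.univ, Set.preimage_univ,
    cond_apply (measurableSet_ne_zero hY), Set.inter_univ]
  exact ENNReal.inv_mul_le_one _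

lemma condLawNeZero_Iio_zero {Y : Ω → ℤ} (hY : Measurable Y) (h : ∀ ω, 0 ≤ Y ω) :
    condLawNeZero P Y (Set.Iio 0) = 0 := by
  rw [condLawNeZero, Measure.map_apply hY measurableSet_Iio]
  convert measure_empty (μ := cond P {ω | Y ω ≠ 0})
  ext ω
  simpa using h ω

variable [IsProbabilityMeasure P]

lemma ofReal_probNeZero (Y : Ω → ℤ) :
    ENNReal.ofReal (probNeZero P Y) = P {ω | Y ω ≠ 0} := by
  rw [probNeZero, ofReal_measureReal]

instance isFiniteMeasure_condLawNeZero (Y : Ω → ℤ) : IsFiniteMeasure (condLawNeZero P Y) := by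
  unfold condLawNeZero
  infer_instance

lemma isProbabilityMeasure_condLawNeZero {Y : Ω → ℤ} (hY : Measurable Y)
    (hp : probNeZero P Y ≠ 0) : IsProbabilityMeasure (condLawNeZero P Y) := by
  have h0 : P {ω | Y ω ≠ 0} ≠ 0 := fun h => hp (by rw [probNeZero, Measure.real, h]; rfl)
  have := cond_isProbabilityMeasure h0
  exact Measure.isProbabilityMeasure_map hY.aemeasurable

lemma map_eq_add_condLawNeZero {Y : Ω → ℤ} (hY : Measurable Y) :
    P.map Y = ENNReal.ofReal (1 - probNeZero P Y) • Measure.dirac 0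
      + ENNReal.ofReal (probNeZero P Y) • condLawNeZero P Y := by
  set s := {ω | Y ω ≠ 0} with hs
  have hsm : MeasurableSet s := measurableSet_ne_zero hY
  have h1 : (P.restrict sᶜ).map Y = ENNReal.ofReal (1 - probNeZero P Y) • Measure.dirac 0 := by
    have h2 : Y =ᵐ[P.restrict sᶜ] fun _ => (0 : ℤ) := by
      refine (ae_restrict_iff' hsm.compl).mpr (ae_of_all _ fun ω hω => ?_)
      simpa [hs] using hω
    rw [Measure.map_congr h2, Measure.map_const, Measure.restrict_apply_univ, probNeZero,
      ← probReal_compl_eq_one_sub hsm, ofReal_measureReal]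
  have h3 : (P.restrict s).map Y = ENNReal.ofReal (probNeZero P Y) • condLawNeZero P Y := by
    rw [ofReal_probNeZero, condLawNeZero, ProbabilityTheory.cond, Measure.map_smul, smul_smul]
    by_cases h0 : P s = 0
    · rw [Measure.restrict_eq_zero.mpr h0]
      simp
    · rw [ENNReal.mul_inv_cancel h0 (measure_ne_top _ _), one_smul]
  rw [← h1, ← h3, ← Measure.map_add _ _ hY, add_comm, Measure.restrict_add_restrict_compl hsm]

lemma probNeZero_le_one (Y : Ω → ℤ) : probNeZero P Y ≤ 1 := measureReal_le_one

lemma integral_map_eq_condLawNeZero {Y : Ω → ℤ} (hY : Measurable Y) {f : ℤ → ℝ}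
    (hf : Integrable f (P.map Y)) :
    ∫ x, f x ∂P.map Y = (1 - probNeZero P Y) * f 0
      + probNeZero P Y * ∫ x, f x ∂condLawNeZero P Y := by
  rw [map_eq_add_condLawNeZero P hY] at hf ⊢
  rw [integral_add_measure hf.left_of_add_measure hf.right_of_add_measure, integral_smul_measure,
    integral_smul_measure, integral_dirac, ENNReal.toReal_ofReal (probNeZero_nonneg P Y),
    ENNReal.toReal_ofReal (sub_nonneg.mpr (probNeZero_le_one P Y))]
  rfl

lemma secondMoment_condLawNeZero_ne_top {Y : Ω → ℤ} (hY : Measurable Y)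
    (h : secondMoment (P.map Y) ≠ ⊤) : secondMoment (condLawNeZero P Y) ≠ ⊤ := by
  by_cases h0 : P {ω | Y ω ≠ 0} = 0
  · have : condLawNeZero P Y = 0 := by
      rw [condLawNeZero, cond_eq_zero_of_meas_eq_zero h0, Measure.map_zero]
    simp [this, secondMoment]
  · rw [map_eq_add_condLawNeZero P hY, secondMoment, lintegral_add_measure, lintegral_smul_measure,
      lintegral_smul_measure, ofReal_probNeZero] at h
    intro h1
    apply h
    rw [secondMoment] at h1
    rw [h1, smul_eq_mul (P _), ENNReal.mul_top h0, add_top]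

/-- Since `f ≥ 0`, only the terms `j = 0, 1` of the Poisson mixture are kept. With `1 - p ≤ e^{-p}`
the excess is at most `p (1 - e^{-p}) ≤ p²`. -/
lemma integral_map_sub_compoundPoisson_le {Y : Ω → ℤ} (hY : Measurable Y) {f : ℤ → ℝ}
    (hf0 : ∀ x, 0 ≤ f x) (hf1 : ∀ x, f x ≤ 1) :
    ∫ x, f x ∂P.map Y - ∫ x, f x ∂compoundPoisson (probNeZero P Y) (condLawNeZero P Y)
      ≤ probNeZero P Y ^ 2 := by
  have := Measure.isProbabilityMeasure_map (μ := P) hY.aemeasurable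
  have hp := probNeZero_nonneg P Y
  have hG := condLawNeZero_univ_le P hY
  have := isFiniteMeasure_compoundPoisson hp _ hG
  set p := probNeZero P Y with hp_def
  set G := condLawNeZero P Y with hG_def
  have hfb : ∀ x, |f x| ≤ 1 := fun x => abs_le.mpr ⟨by linarith [hf0 x], hf1 x⟩
  have h1 := integral_map_eq_condLawNeZero P hY (integrable_of_bound hfb)
  have h2 := hasSum_integral_compoundPoisson hp G
    (integrable_of_bound (μ := compoundPoisson p G) hfb)
  have h3 := sum_le_hasSum (Finset.range 2) (fun j _ => smul_nonneg (poisson_weight_nonneg hp j)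
    (integral_nonneg hf0)) h2
  rw [Finset.sum_range_succ, Finset.sum_range_one, convPower_one, convPower] at h3
  simp only [pow_zero, Nat.factorial, smul_eq_mul, integral_dirac, pow_one] at h3
  have h4 : ∫ x, f x ∂G ≤ 1 := by
    have h5 : ∫ x, f x ∂G ≤ ∫ _, (1 : ℝ) ∂G :=
      integral_mono (integrable_of_bound hfb) (integrable_const 1) hf1
    have h6 : G.real Set.univ ≤ 1 := ENNReal.toReal_le_of_le_ofReal zero_le_one (by simpa using hG)
    simpa using h5.trans (by simpa using h6)
  have h5 : 0 ≤ ∫ x, f x ∂G := integral_nonneg hf0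
  have h6 := Real.add_one_le_exp (-p)
  have h7 : Real.exp (-p) ≤ 1 := Real.exp_le_one_iff.mpr (by linarith)
  rw [h1]
  set I := ∫ x, f x ∂G
  set e := Real.exp (-p)
  have h8 := hf0 0
  push_cast at h3
  have h9 : 0 ≤ (e - (1 - p)) * f 0 := mul_nonneg (by linarith) h8
  have h10 : p * (1 - e) * I ≤ p * (1 - e) * 1 :=
    mul_le_mul_of_nonneg_left h4 (mul_nonneg hp (by linarith))
  have h11 : p * (1 - e) ≤ p * p := mul_le_mul_of_nonneg_left (by linarith) hp
  simp only [mul_one, div_one] at h3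
  nlinarith

/-- The one-sided bound for `1 - f` is the missing lower bound for `f`. -/
lemma abs_integral_map_sub_compoundPoisson_le {Y : Ω → ℤ} (hY : Measurable Y)
    [IsProbabilityMeasure (compoundPoisson (probNeZero P Y) (condLawNeZero P Y))] {f : ℤ → ℝ}
    (hf0 : ∀ x, 0 ≤ f x) (hf1 : ∀ x, f x ≤ 1) :
    |∫ x, f x ∂P.map Y - ∫ x, f x ∂compoundPoisson (probNeZero P Y) (condLawNeZero P Y)|
      ≤ probNeZero P Y ^ 2 := by
  have := Measure.isProbabilityMeasure_map (μ := P) hY.aemeasurable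
  have hfb : ∀ x, |f x| ≤ 1 := fun x => abs_le.mpr ⟨by linarith [hf0 x], hf1 x⟩
  have h1 := integral_map_sub_compoundPoisson_le P hY hf0 hf1
  have h2 := integral_map_sub_compoundPoisson_le P hY (f := fun x => 1 - f x)
    (fun x => by linarith [hf1 x]) (fun x => by linarith [hf0 x])
  rw [integral_sub (integrable_const _) (integrable_of_bound hfb),
    integral_sub (integrable_const _) (integrable_of_bound hfb)] at h2
  simp only [integral_const, probReal_univ, smul_eq_mul, one_mul] at h2
  exact abs_le.mpr ⟨by linarith, h1⟩

end Law

/-! ### Exchanging the distant past for an independent variable. -/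

section Exchange

variable {Ω : Type*} [MeasurableSpace Ω] {P : Measure Ω} [IsProbabilityMeasure P]

lemma integral_comp_eq_of_indepFun {S T : Type*} [MeasurableSpace S] [MeasurableSpace T]
    [Countable S] [Countable T] [MeasurableSingletonClass S] [MeasurableSingletonClass T]
    {X : Ω → S} {Y : Ω → T} (hX : Measurable X) (hY : Measurable Y) (hXY : IndepFun X Y P)
    {g : S → T → ℝ} {C : ℝ} (hg : ∀ s t, |g s t| ≤ C) :
    ∫ ω, g (X ω) (Y ω) ∂P = ∫ s, ∫ ω, g s (Y ω) ∂P ∂P.map X := by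
  have := Measure.isProbabilityMeasure_map (μ := P) hX.aemeasurable
  have := Measure.isProbabilityMeasure_map (μ := P) hY.aemeasurable
  have hm : Measurable fun z : S × T => g z.1 z.2 := measurable_of_countable _
  have h1 : ∫ ω, g (X ω) (Y ω) ∂P = ∫ z : S × T, g z.1 z.2 ∂P.map fun ω => (X ω, Y ω) := by
    rw [integral_map (hX.prodMk hY).aemeasurable hm.aestronglyMeasurable]
  rw [h1, (indepFun_iff_map_prod_eq_prod_map_map hX.aemeasurable hY.aemeasurable).mp hXY,
    integral_prod]
  · refine integral_congr_ae (ae_of_all _ fun s => ?_)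
    change ∫ t, g s t ∂P.map Y = _
    rw [integral_map hY.aemeasurable (measurable_of_countable _).aestronglyMeasurable]
  · exact Integrable.of_bound hm.aestronglyMeasurable C (ae_of_all _ fun z => hg _ _)

lemma integrable_comp_of_bound {T : Type*} [MeasurableSpace T] [Countable T]
    [MeasurableSingletonClass T] {Y : Ω → T} (hY : Measurable Y) {g : T → ℝ} {C : ℝ}
    (hg : ∀ t, |g t| ≤ C) : Integrable (fun ω => g (Y ω)) P :=
  Integrable.of_bound ((measurable_of_countable g).comp hY).aestronglyMeasurable C
    (ae_of_all _ fun _ => hg _)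

/-- Replacing `A + B` by an independent variable with distribution `ρ` in the first argument of
a function dominated by a function of `T` alone. -/
lemma abs_integral_exchange_le {T : Type*} [MeasurableSpace T] [Countable T]
    [MeasurableSingletonClass T] {A B : Ω → ℤ} {Y : Ω → T} (hA : Measurable A) (hB : Measurable B)
    (hY : Measurable Y) (hAY : IndepFun A Y P) {G : ℤ → T → ℝ} {b : T → ℝ} {C : ℝ}
    (hG : ∀ w t, |G w t| ≤ b t) (hb : ∀ t, b t ≤ C) (hBY : IndepFun B (fun ω => b (Y ω)) P)
    (ρ : Measure ℤ) [IsProbabilityMeasure ρ] :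
    |∫ ω, G (A ω + B ω) (Y ω) ∂P - ∫ w, ∫ ω, G w (Y ω) ∂P ∂ρ|
      ≤ 2 * (tvDist (P.map A) ρ + probNeZero P B) * ∫ ω, b (Y ω) ∂P := by
  have := Measure.isProbabilityMeasure_map (μ := P) hA.aemeasurable
  have hb0 : ∀ t, 0 ≤ b t := fun t => (abs_nonneg _).trans (hG 0 t)
  have hGC : ∀ w t, |G w t| ≤ C := fun w t => (hG w t).trans (hb t)
  have hbC : ∀ t, |b t| ≤ C := fun t => by rw [abs_of_nonneg (hb0 t)]; exact hb t
  have hbi : Integrable (fun ω => b (Y ω)) P := integrable_comp_of_bound hY hbC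
  have hi1 : Integrable (fun ω => G (A ω + B ω) (Y ω)) P :=
    integrable_comp_of_bound (g := fun z : ℤ × T => G z.1 z.2) ((hA.add hB).prodMk hY)
      fun z => hGC _ _
  have hi2 : Integrable (fun ω => G (A ω) (Y ω)) P :=
    integrable_comp_of_bound (g := fun z : ℤ × T => G z.1 z.2) (hA.prodMk hY)
      fun z => hGC _ _
  have hi3 : Integrable (fun ω => 2 * (({0}ᶜ : Set ℤ).indicator 1 (B ω) * b (Y ω))) P := by
    refine integrable_comp_of_bound (C := 2 * C)
      (g := fun z : ℤ × T => 2 * (({0}ᶜ : Set ℤ).indicator 1 z.1 * b z.2)) (hB.prodMk hY)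
      fun z => ?_
    have h0 := hb0 z.2
    have h1 := hb z.2
    by_cases hz : z.1 = 0
    · simp [hz]; linarith
    · simp [hz, abs_of_nonneg h0]; linarith
  -- Dropping `B` changes the integrand only where `B ≠ 0`, and by at most `2 b(Y)`. Independence of
  -- `B` from `b(Y)`, not from `Y` itself, is enough to factor the mean.
  have h1 : |∫ ω, G (A ω + B ω) (Y ω) ∂P - ∫ ω, G (A ω) (Y ω) ∂P|
      ≤ 2 * (probNeZero P B * ∫ ω, b (Y ω) ∂P) := by
    rw [← integral_sub hi1 hi2]
    refine (abs_integral_le_integral_abs).trans ?_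
    have h2 : ∫ ω, 2 * (({0}ᶜ : Set ℤ).indicator 1 (B ω) * b (Y ω)) ∂P
        = 2 * (probNeZero P B * ∫ ω, b (Y ω) ∂P) := by
      rw [integral_const_mul]
      congr 1
      have h3 := (hBY.comp (φ := ({0}ᶜ : Set ℤ).indicator (1 : ℤ → ℝ)) (ψ := id)
        (measurable_of_countable _) measurable_id).integral_fun_mul_eq_mul_integral
        ((measurable_of_countable _).comp hB).aestronglyMeasurable hbi.aestronglyMeasurable
      refine h3.trans ?_
      congr 1
      have h4 : (({0}ᶜ : Set ℤ).indicator (1 : ℤ → ℝ)) ∘ B = {ω | B ω ≠ 0}.indicator 1 := by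
        funext ω
        by_cases hω : B ω = 0 <;> simp [hω]
      rw [h4, integral_indicator_one (measurableSet_ne_zero hB), probNeZero]
    rw [← h2]
    refine integral_mono (hi1.sub hi2).abs hi3 fun ω => ?_
    by_cases hω : B ω = 0
    · simp [hω]
    · have h4 := hG (A ω + B ω) (Y ω)
      have h5 := hG (A ω) (Y ω)
      have h6 := abs_sub (G (A ω + B ω) (Y ω)) (G (A ω) (Y ω))
      simp [hω]
      linarith
  -- `A` is independent of all of `Y`, so it can be integrated last, against a function bounded by
  -- the mean of `b(Y)`; changing its law to `ρ` then costs total variation.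
  rw [integral_comp_eq_of_indepFun hA hY hAY hGC] at h1
  have h2 : ∀ w, |∫ ω, G w (Y ω) ∂P| ≤ ∫ ω, b (Y ω) ∂P := fun w =>
    abs_integral_le_integral_abs.trans
      (integral_mono (integrable_comp_of_bound hY (hGC w)).abs hbi fun ω => hG w (Y ω))
  have h3 := abs_integral_sub_le_tvDist (P.map A) ρ h2
  have h4 := abs_sub_le (∫ ω, G (A ω + B ω) (Y ω) ∂P) (∫ s, ∫ ω, G s (Y ω) ∂P ∂P.map A)
    (∫ w, ∫ ω, G w (Y ω) ∂P ∂ρ)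
  linarith

lemma abs_integral_le_of_zero {Y : Ω → ℤ} (hY : Measurable Y) {g : ℤ → ℝ} (h0 : g 0 = 0)
    {C : ℝ} (hg : ∀ x, |g x| ≤ C) : |∫ x, g x ∂P.map Y| ≤ C * probNeZero P Y := by
  rw [integral_map hY.aemeasurable (measurable_of_countable _).aestronglyMeasurable]
  have h1 : ∫ ω, {ω | Y ω ≠ 0}.indicator (fun _ => C) ω ∂P = C * probNeZero P Y := by
    rw [integral_indicator_const _ (measurableSet_ne_zero hY), probNeZero, smul_eq_mul, mul_comm]
  rw [← h1]
  refine abs_integral_le_integral_abs.trans (integral_mono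
    (integrable_comp_of_bound hY hg).abs
    ((integrable_const C).indicator (measurableSet_ne_zero hY)) fun ω => ?_)
  by_cases hω : Y ω = 0
  · simp [hω, h0]
  · simpa [hω] using hg (Y ω)

lemma abs_integral_le_one (μ : Measure ℤ) [IsProbabilityMeasure μ] {g : ℤ → ℝ}
    (hg : ∀ x, |g x| ≤ 1) : |∫ x, g x ∂μ| ≤ 1 := by
  simpa using norm_integral_le_of_norm_le_const (μ := μ) (f := g) (ae_of_all _ hg)

/-- The error of replacing `A + B` by an independent variable with distribution `ρ` in the
difference of the expectations of `f (A + B + U + V + X)` and `f (A + B + U + V + N)`. -/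
lemma abs_lindeberg_exchange_le {A B U V X : Ω → ℤ} (hA : Measurable A) (hB : Measurable B)
    (hU : Measurable U) (hV : Measurable V) (hX : Measurable X)
    (hAT : IndepFun A (fun ω => (U ω, V ω, X ω)) P)
    (hBT : IndepFun B (fun ω => (V ω, X ω)) P)
    (hWX : IndepFun (fun ω => A ω + B ω + U ω) X P) (hUX : IndepFun U X P)
    (ρ q : Measure ℤ) [IsProbabilityMeasure ρ] [IsProbabilityMeasure q] {f : ℤ → ℝ}
    (hf0 : ∀ x, 0 ≤ f x) (hf1 : ∀ x, f x ≤ 1) {p : ℝ} (hp : p = probNeZero P X)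
    (hq : ∀ c, |∫ x, f (c + x) ∂P.map X - ∫ x, f (c + x) ∂q| ≤ p ^ 2) :
    |(∫ ω, f (A ω + B ω + U ω + V ω + X ω) ∂P - ∫ ω, ∫ y, f (A ω + B ω + U ω + V ω + y) ∂q ∂P)
      - ∫ w, (∫ ω, f (w + U ω + V ω + X ω) ∂P - ∫ ω, ∫ y, f (w + U ω + V ω + y) ∂q ∂P) ∂ρ|
      ≤ 2 * (tvDist (P.map A) ρ + probNeZero P B)
        * (2 * P.real {ω | V ω ≠ 0 ∧ X ω ≠ 0} + 2 * p * probNeZero P V + p ^ 2) := by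
  have := Measure.isProbabilityMeasure_map (μ := P) hX.aemeasurable
  set L := P.map X with hL
  have hfb : ∀ x, |f x| ≤ 1 := fun x => abs_le.mpr ⟨by linarith [hf0 x], hf1 x⟩
  have hint : ∀ (μ : Measure ℤ) [IsProbabilityMeasure μ] (c : ℤ), |∫ x, f (c + x) ∂μ| ≤ 1 :=
    fun μ _ c => abs_integral_le_one μ fun x => hfb _
  have hp0 : 0 ≤ p := hp ▸ probNeZero_nonneg P X
  have hp1 : p ≤ 1 := hp ▸ probNeZero_le_one P X
  let T : Ω → ℤ × ℤ × ℤ := fun ω => (U ω, V ω, X ω)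
  have hT : Measurable T := hU.prodMk (hV.prodMk hX)
  -- The subtracted bracket omits `V` and uses the true law of `X`, so it has mean zero by
  -- independence of `W + U` and `X`. Subtracting it creates a second-order difference.
  let G : ℤ → ℤ × ℤ × ℤ → ℝ := fun w t =>
    f (w + t.1 + t.2.1 + t.2.2) - ∫ y, f (w + t.1 + t.2.1 + y) ∂q
      - (f (w + t.1 + t.2.2) - ∫ x, f (w + t.1 + x) ∂L)
  let b' : ℤ × ℤ → ℝ := fun t =>
    2 * ({t | t.1 ≠ 0 ∧ t.2 ≠ 0} : Set (ℤ × ℤ)).indicator 1 t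
      + 2 * p * ({0}ᶜ : Set ℤ).indicator 1 t.1 + p ^ 2
  let b : ℤ × ℤ × ℤ → ℝ := fun t => b' t.2
  have hG : ∀ w t, |G w t| ≤ b t := by
    rintro w ⟨u, v, x⟩
    -- This mixed difference vanishes if `v = 0` or `x = 0` and is at most `2` in size. `G` equals
    -- `g x`, minus the mean of `g`, plus the error of replacing `L` by `q`: these give the three
    -- terms of `b'`.
    set g : ℤ → ℝ := fun x => f (w + u + v + x) - f (w + u + v) - f (w + u + x) + f (w + u)
      with hg
    have hg2 : ∀ x, |g x| ≤ 2 := fun x => by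
      have h1 := hf0 (w + u + v + x); have h2 := hf1 (w + u + v + x)
      have h3 := hf0 (w + u + v); have h4 := hf1 (w + u + v)
      have h5 := hf0 (w + u + x); have h6 := hf1 (w + u + x)
      have h7 := hf0 (w + u); have h8 := hf1 (w + u)
      exact abs_le.mpr ⟨by simp only [hg]; linarith, by simp only [hg]; linarith⟩
    have hgv : v = 0 → ∀ x, g x = 0 := fun hv x => by simp [hg, hv]
    have hg0 : g 0 = 0 := by simp [hg]
    have hgint : ∫ x, g x ∂L = ∫ x, f (w + u + v + x) ∂L - f (w + u + v)
        - ∫ x, f (w + u + x) ∂L + f (w + u) := by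
      have i1 : Integrable (fun x => f (w + u + v + x)) L := integrable_of_bound fun x => hfb _
      have i2 : Integrable (fun x => f (w + u + x)) L := integrable_of_bound fun x => hfb _
      have i3 : Integrable (fun x => f (w + u + v + x) - f (w + u + v)) L :=
        i1.sub (integrable_const _)
      have i4 : Integrable (fun x => f (w + u + v + x) - f (w + u + v) - f (w + u + x)) L :=
        i3.sub i2
      simp only [hg]
      rw [integral_add i4 (integrable_const _), integral_sub i3 i2,
        integral_sub i1 (integrable_const _)]
      simp
    have hGe : G w (u, v, x) = g x - ∫ x, g x ∂L
        + (∫ x, f (w + u + v + x) ∂L - ∫ x, f (w + u + v + x) ∂q) := by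
      rw [hgint]
      simp only [G, hg]
      ring
    have k1 : |g x| ≤ 2 * ({t | t.1 ≠ 0 ∧ t.2 ≠ 0} : Set (ℤ × ℤ)).indicator 1 (v, x) := by
      by_cases hv : v = 0
      · simp [hv, hgv hv]
      by_cases hx : x = 0
      · simp [hx, hg0]
      simpa [hv, hx] using hg2 x
    have k2 : |∫ x, g x ∂L| ≤ 2 * p * ({0}ᶜ : Set ℤ).indicator 1 v := by
      by_cases hv : v = 0
      · simp [hgv hv, hv]
      · simpa [hv, hp] using abs_integral_le_of_zero hX hg0 hg2
    have k3 := hq (w + u + v)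
    have k4 := abs_add_le (g x - ∫ x, g x ∂L)
      (∫ x, f (w + u + v + x) ∂L - ∫ x, f (w + u + v + x) ∂q)
    have k5 := abs_sub (g x) (∫ x, g x ∂L)
    rw [hGe]
    simp only [b, b']
    linarith
  have hb' : ∀ t, b' t ≤ 5 := fun t => by
    have k1 : ({t | t.1 ≠ 0 ∧ t.2 ≠ 0} : Set (ℤ × ℤ)).indicator (1 : ℤ × ℤ → ℝ) t ≤ 1 :=
      Set.indicator_le_self' (fun _ _ => zero_le_one) t
    have k2 : ({0}ᶜ : Set ℤ).indicator (1 : ℤ → ℝ) t.1 ≤ 1 :=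
      Set.indicator_le_self' (fun _ _ => zero_le_one) t.1
    have k3 : p * ({0}ᶜ : Set ℤ).indicator (1 : ℤ → ℝ) t.1 ≤ p * 1 :=
      mul_le_mul_of_nonneg_left k2 hp0
    have k4 : p ^ 2 ≤ 1 := pow_le_one₀ hp0 hp1
    simp only [b']
    linarith
  have hBb : IndepFun B (fun ω => b (T ω)) P :=
    hBT.comp (φ := id) (ψ := b') measurable_id (measurable_of_countable _)
  have key := abs_integral_exchange_le hA hB hT hAT hG (fun t => hb' t.2) hBb ρ
  have hbint : ∫ ω, b (T ω) ∂P
      = 2 * P.real {ω | V ω ≠ 0 ∧ X ω ≠ 0} + 2 * p * probNeZero P V + p ^ 2 := by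
    have hs : MeasurableSet {ω | V ω ≠ 0 ∧ X ω ≠ 0} :=
      (measurableSet_ne_zero hV).inter (measurableSet_ne_zero hX)
    have hbe : (fun ω => b (T ω)) = fun ω => 2 * {ω | V ω ≠ 0 ∧ X ω ≠ 0}.indicator 1 ω
        + 2 * p * {ω | V ω ≠ 0}.indicator 1 ω + p ^ 2 := by
      funext ω
      by_cases hv : V ω = 0 <;> by_cases hx : X ω = 0 <;> simp [b, b', T, hv, hx]
    have i1 : Integrable ({ω | V ω ≠ 0 ∧ X ω ≠ 0}.indicator (1 : Ω → ℝ)) P :=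
      (integrable_const (1 : ℝ)).indicator hs
    have i2 : Integrable ({ω | V ω ≠ 0}.indicator (1 : Ω → ℝ)) P :=
      (integrable_const (1 : ℝ)).indicator (measurableSet_ne_zero hV)
    have i3 : Integrable (fun ω => 2 * {ω | V ω ≠ 0 ∧ X ω ≠ 0}.indicator (1 : Ω → ℝ) ω
        + 2 * p * {ω | V ω ≠ 0}.indicator (1 : Ω → ℝ) ω) P :=
      (i1.const_mul 2).add (i2.const_mul (2 * p))
    rw [hbe, integral_add i3 (integrable_const _),
      integral_add (i1.const_mul 2) (i2.const_mul (2 * p)), integral_const_mul,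
      integral_const_mul, integral_indicator_one hs,
      integral_indicator_one (measurableSet_ne_zero hV)]
    simp [probNeZero]
  have hrest : ∀ W : Ω → ℤ, Measurable W → IndepFun W X P →
      ∫ ω, (f (W ω + X ω) - ∫ x, f (W ω + x) ∂L) ∂P = 0 := fun W hW hWX' => by
    rw [integral_sub
      (integrable_comp_of_bound (g := fun z : ℤ × ℤ => f (z.1 + z.2)) (hW.prodMk hX)
        fun z => hfb _)
      (integrable_comp_of_bound (g := fun w => ∫ x, f (w + x) ∂L) hW fun w => hint L w),
      integral_comp_eq_of_indepFun hW hX hWX' (g := fun w x => f (w + x)) fun w x => hfb _,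
      integral_map hW.aemeasurable (measurable_of_countable _).aestronglyMeasurable, sub_eq_zero]
    refine integral_congr_ae (ae_of_all _ fun ω => ?_)
    exact (integral_map (f := fun x => f (W ω + x)) hX.aemeasurable
      (measurable_of_countable _).aestronglyMeasurable).symm
  have hsplit : ∀ W : Ω → ℤ, Measurable W → IndepFun (fun ω => W ω + U ω) X P →
      ∫ ω, G (W ω) (T ω) ∂P = ∫ ω, f (W ω + U ω + V ω + X ω) ∂P
        - ∫ ω, ∫ y, f (W ω + U ω + V ω + y) ∂q ∂P := fun W hW hWUX => by
    have hS := (hW.add hU).add hV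
    have i1 : Integrable (fun ω => f (W ω + U ω + V ω + X ω)) P :=
      integrable_comp_of_bound (hS.add hX) hfb
    have i2 : Integrable (fun ω => ∫ y, f (W ω + U ω + V ω + y) ∂q) P :=
      integrable_comp_of_bound (g := fun w => ∫ x, f (w + x) ∂q) hS fun w => hint q w
    have i3 : Integrable (fun ω => f (W ω + U ω + X ω) - ∫ x, f (W ω + U ω + x) ∂L) P :=
      (integrable_comp_of_bound ((hW.add hU).add hX) hfb).sub
        (integrable_comp_of_bound (g := fun w => ∫ x, f (w + x) ∂L) (hW.add hU)
          fun w => hint L w)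
    have i4 : Integrable (fun ω => f (W ω + U ω + V ω + X ω)
        - ∫ y, f (W ω + U ω + V ω + y) ∂q) P := i1.sub i2
    simp only [G, T]
    rw [integral_sub i4 i3, integral_sub i1 i2,
      hrest (fun ω => W ω + U ω) (hW.add hU) hWUX, sub_zero]
  rw [hbint, hsplit (fun ω => A ω + B ω) (hA.add hB) hWX] at key
  -- The same cancellation for a constant `w`, where independence of `U` and `X` suffices.
  have hw : ∀ w : ℤ, ∫ ω, G w (T ω) ∂P = ∫ ω, f (w + U ω + V ω + X ω) ∂P
      - ∫ ω, ∫ y, f (w + U ω + V ω + y) ∂q ∂P := fun w =>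
    hsplit (fun _ => w) measurable_const
      (hUX.comp (φ := fun u => w + u) (ψ := id) (measurable_of_countable _) measurable_id)
  simp_rw [hw] at key
  exact key

end Exchange

/-! ### The exchange expressed through convolutions of laws. -/

lemma abs_indicator_one_le (E : Set ℤ) (x : ℤ) : |E.indicator (1 : ℤ → ℝ) x| ≤ 1 := by
  by_cases hx : x ∈ E <;> simp [hx]

lemma conv_real_eq_integral (μ ν : Measure ℤ) [IsFiniteMeasure μ] [IsFiniteMeasure ν]
    (E : Set ℤ) :
    (μ.conv ν).real E = ∫ x, ∫ y, E.indicator (1 : ℤ → ℝ) (x + y) ∂ν ∂μ := by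
  rw [← integral_conv (integrable_of_bound (abs_indicator_one_le E)),
    integral_indicator_one E.to_countable.measurableSet]

section Step

variable {Ω : Type*} [MeasurableSpace Ω] {P : Measure Ω} [IsProbabilityMeasure P]

/-- One step of the Lindeberg telescope: up to the stated error, the initial sum `A + B` may be
replaced by an independent variable with distribution `ρ`. -/
lemma abs_lindeberg_step_le {A B U V X : Ω → ℤ} (hA : Measurable A) (hB : Measurable B)
    (hU : Measurable U) (hV : Measurable V) (hX : Measurable X)
    (hAT : IndepFun A (fun ω => (U ω, V ω, X ω)) P)
    (hBT : IndepFun B (fun ω => (V ω, X ω)) P)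
    (hWX : IndepFun (fun ω => A ω + B ω + U ω) X P) (hUX : IndepFun U X P)
    (ρ ν q : Measure ℤ) [IsProbabilityMeasure ρ] [IsProbabilityMeasure ν] [IsProbabilityMeasure q]
    (hq : q = compoundPoisson (probNeZero P X) (condLawNeZero P X)) (E : Set ℤ) :
    |((P.map fun ω => A ω + B ω + U ω + V ω + X ω).conv ν).real E
      - (((P.map fun ω => A ω + B ω + U ω + V ω).conv q).conv ν).real E|
      ≤ |((ρ.conv ν).conv (P.map fun ω => U ω + V ω + X ω)).real E
          - ((ρ.conv ν).conv ((P.map fun ω => U ω + V ω).conv q)).real E|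
        + 2 * (tvDist (P.map A) ρ + probNeZero P B)
          * (2 * P.real {ω | V ω ≠ 0 ∧ X ω ≠ 0} + 2 * probNeZero P X * probNeZero P V
            + probNeZero P X ^ 2) := by
  -- The independent tail `ν` is absorbed into the test function, which keeps values in `[0, 1]`.
  set f : ℤ → ℝ := fun x => ∫ y, E.indicator (1 : ℤ → ℝ) (x + y) ∂ν with hf
  have hf0 : ∀ x, 0 ≤ f x := fun x => integral_nonneg fun y =>
    Set.indicator_nonneg (fun _ _ => zero_le_one) _
  have hfb : ∀ x, |f x| ≤ 1 := fun x =>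
    abs_integral_le_one ν fun y => abs_indicator_one_le E (x + y)
  have hf1 : ∀ x, f x ≤ 1 := fun x => (le_abs_self _).trans (hfb x)
  have hqprob : IsProbabilityMeasure (compoundPoisson (probNeZero P X) (condLawNeZero P X)) :=
    hq ▸ inferInstance
  have hqb : ∀ c, |∫ x, f (c + x) ∂P.map X - ∫ x, f (c + x) ∂q| ≤ probNeZero P X ^ 2 := fun c => by
    rw [hq]
    exact abs_integral_map_sub_compoundPoisson_le P hX (fun x => hf0 _) fun x => hf1 _
  have key := abs_lindeberg_exchange_le hA hB hU hV hX hAT hBT hWX hUX ρ q hf0 hf1 rfl hqb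
  have hmap : ∀ (S : Ω → ℤ), Measurable S → ∀ g : ℤ → ℝ, ∫ ω, g (S ω) ∂P = ∫ x, g x ∂P.map S :=
    fun S hS g => (integral_map hS.aemeasurable
      (measurable_of_countable _).aestronglyMeasurable).symm
  have hconv : ∀ μ μ' : Measure ℤ, [IsFiniteMeasure μ] → [IsFiniteMeasure μ'] →
      ∫ x, ∫ y, f (x + y) ∂μ' ∂μ = ((μ.conv μ').conv ν).real E := fun μ μ' _ _ => by
    rw [conv_real_eq_integral, integral_conv (integrable_of_bound hfb)]
  have hUV : Measurable fun ω => U ω + V ω := hU.add hV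
  have hS : Measurable fun ω => A ω + B ω + U ω + V ω := ((hA.add hB).add hU).add hV
  have hSX : Measurable fun ω => A ω + B ω + U ω + V ω + X ω := hS.add hX
  have hUVX : Measurable fun ω => U ω + V ω + X ω := hUV.add hX
  have := Measure.isProbabilityMeasure_map (μ := P) hUV.aemeasurable
  have := Measure.isProbabilityMeasure_map (μ := P) hS.aemeasurable
  have := Measure.isProbabilityMeasure_map (μ := P) hSX.aemeasurable
  have := Measure.isProbabilityMeasure_map (μ := P) hUVX.aemeasurable
  have h1 : ∫ ω, f (A ω + B ω + U ω + V ω + X ω) ∂P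
      = ((P.map fun ω => A ω + B ω + U ω + V ω + X ω).conv ν).real E := by
    rw [hmap _ hSX f, conv_real_eq_integral]
  have h2 : ∫ ω, ∫ y, f (A ω + B ω + U ω + V ω + y) ∂q ∂P
      = (((P.map fun ω => A ω + B ω + U ω + V ω).conv q).conv ν).real E := by
    rw [hmap _ hS fun x => ∫ y, f (x + y) ∂q, hconv]
  have h3 : ∀ w, ∫ ω, f (w + U ω + V ω + X ω) ∂P
      = ∫ s, f (w + s) ∂P.map fun ω => U ω + V ω + X ω := fun w => by
    rw [← hmap _ hUVX fun s => f (w + s)]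
    simp only [add_assoc]
  have h4 : ∀ w, ∫ ω, ∫ y, f (w + U ω + V ω + y) ∂q ∂P
      = ∫ s, f (w + s) ∂(P.map fun ω => U ω + V ω).conv q := fun w => by
    rw [integral_conv (integrable_of_bound fun s => hfb _),
      ← hmap _ hUV fun s => ∫ y, f (w + (s + y)) ∂q]
    simp only [add_assoc]
  -- `ρ` and `ν` are brought together, since jointly they act as the smoothing factor.
  have hswap : ∀ μ : Measure ℤ, [IsFiniteMeasure μ] → (ρ.conv μ).conv ν = (ρ.conv ν).conv μ :=
    fun μ _ => by rw [Measure.conv_assoc, Measure.conv_comm μ ν, Measure.conv_assoc]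
  have hint : ∀ μ : Measure ℤ, [IsProbabilityMeasure μ] →
      Integrable (fun w => ∫ s, f (w + s) ∂μ) ρ := fun μ _ =>
    integrable_of_bound (C := 1) fun w => abs_integral_le_one μ fun s => hfb (w + s)
  simp_rw [h3, h4] at key
  rw [h1, h2, integral_sub (hint _) (hint _), hconv, hconv, hswap, hswap] at key
  set a := ((P.map fun ω => A ω + B ω + U ω + V ω + X ω).conv ν).real E
    - (((P.map fun ω => A ω + B ω + U ω + V ω).conv q).conv ν).real E
  set d := ((ρ.conv ν).conv (P.map fun ω => U ω + V ω + X ω)).real E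
    - ((ρ.conv ν).conv ((P.map fun ω => U ω + V ω).conv q)).real E
  have h5 : |a| ≤ |d| + |a - d| := by
    have := abs_add_le d (a - d)
    rwa [add_sub_cancel] at this
  linarith

end Step

/-! ### Independence of disjoint blocks and interval sums. -/

section Blocks

variable {Ω β : Type*} [MeasurableSpace β]

/-- The `σ`-algebra generated by the `Y j` with `j ∈ S`. -/
abbrev blockSigma (Y : ℤ → Ω → β) (S : Set ℤ) : MeasurableSpace Ω :=
  ⨆ j ∈ S, MeasurableSpace.comap (Y j) inferInstance

lemma measurable_blockSigma (Y : ℤ → Ω → β) {S : Set ℤ} {j : ℤ} (hj : j ∈ S) :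
    Measurable[blockSigma Y S] (Y j) :=
  Measurable.mono (comap_measurable (Y j))
    (le_iSup₂ (f := fun j (_ : j ∈ S) => MeasurableSpace.comap (Y j) inferInstance) j hj) le_rfl

variable [MeasurableSpace Ω]

lemma blockSigma_le {Y : ℤ → Ω → β} {S : Set ℤ} (hY : ∀ j ∈ S, Measurable (Y j)) :
    blockSigma Y S ≤ ‹MeasurableSpace Ω› :=
  iSup₂_le fun j hj => (hY j hj).comap_le

lemma indep_blockSigma {P : Measure Ω} {Y : ℤ → Ω → β} {I : Set ℤ}
    (hY : ∀ j ∈ I, Measurable (Y j)) (hind : iIndepFun (fun j : I => Y j) P) {S T : Set ℤ}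
    (hS : S ⊆ I) (hT : T ⊆ I) (hST : Disjoint S T) :
    Indep (blockSigma Y S) (blockSigma Y T) P := by
  have h := indep_iSup_of_disjoint (fun j : I => (hY j j.2).comap_le) hind.iIndep
    (S := Subtype.val ⁻¹' S) (T := Subtype.val ⁻¹' T) (hST.preimage _)
  have hle : ∀ {S : Set ℤ}, S ⊆ I → blockSigma Y S ≤ ⨆ j ∈ (Subtype.val ⁻¹' S : Set I),
      MeasurableSpace.comap (Y j) inferInstance := fun {S} hS => iSup₂_le fun j hj =>
    le_iSup₂ (f := fun (j : I) (_ : j ∈ (Subtype.val ⁻¹' S : Set I)) =>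
      MeasurableSpace.comap (Y j) inferInstance) ⟨j, hS hj⟩ hj
  exact indep_of_indep_of_le_left (indep_of_indep_of_le_right h (hle hT)) (hle hS)

lemma indepFun_of_indep {S T : Type*} [MeasurableSpace S] [MeasurableSpace T] {P : Measure Ω}
    {m₁ m₂ : MeasurableSpace Ω} (h : Indep m₁ m₂ P) {f : Ω → S} {g : Ω → T}
    (hf : Measurable[m₁] f) (hg : Measurable[m₂] g) : IndepFun f g P :=
  (IndepFun_iff_Indep _ _ _).mpr
    (indep_of_indep_of_le_left (indep_of_indep_of_le_right h hg.comap_le) hf.comap_le)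

end Blocks

lemma sum_Icc_split {M : Type*} [AddCommMonoid M] (g : ℤ → M) {a b c : ℤ} (hab : a ≤ b + 1)
    (hbc : b ≤ c) :
    ∑ j ∈ Finset.Icc a c, g j = ∑ j ∈ Finset.Icc a b, g j + ∑ j ∈ Finset.Icc (b + 1) c, g j := by
  rw [← Finset.sum_union]
  · congr 1
    ext j
    simp only [Finset.mem_Icc, Finset.mem_union]
    omega
  · rw [Finset.disjoint_left]
    intro j
    simp only [Finset.mem_Icc]
    omega

lemma sum_Icc_telescope (g : ℤ → ℝ) (n : ℕ) :
    ∑ i ∈ Finset.Icc (1 : ℤ) n, (g i - g (i - 1)) = g n - g 0 := by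
  induction n with
  | zero => simp
  | succ n ih =>
    rw [sum_Icc_split _ (b := n) (by omega) (by push_cast; omega), ih]
    have : Finset.Icc ((n : ℤ) + 1) ((n + 1 : ℕ) : ℤ) = {(n : ℤ) + 1} := by simp
    rw [this, Finset.sum_singleton]
    push_cast
    rw [add_sub_cancel_right]
    ring

/-! ### Laws of sums over integer intervals. -/

section LawSum

variable {Ω : Type*} [MeasurableSpace Ω] (P : Measure Ω)

lemma lawSum_self (Y : ℤ → Ω → ℤ) (a : ℤ) : lawSum P Y a a = P.map (Y a) := by
  simp [lawSum]

lemma measurable_sum_Icc {Y : ℤ → Ω → ℤ} {a b : ℤ}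
    (hY : ∀ j, a ≤ j → j ≤ b → Measurable (Y j)) :
    Measurable fun ω => ∑ j ∈ Finset.Icc a b, Y j ω :=
  Finset.measurable_fun_sum _ fun j hj => hY j (Finset.mem_Icc.mp hj).1 (Finset.mem_Icc.mp hj).2

variable [IsProbabilityMeasure P]

lemma isProbabilityMeasure_lawSum {Y : ℤ → Ω → ℤ} {a b : ℤ}
    (hY : ∀ j, a ≤ j → j ≤ b → Measurable (Y j)) : IsProbabilityMeasure (lawSum P Y a b) :=
  Measure.isProbabilityMeasure_map (measurable_sum_Icc hY).aemeasurable

lemma lawSum_of_lt (Y : ℤ → Ω → ℤ) {a b : ℤ} (hab : b < a) :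
    lawSum P Y a b = Measure.dirac 0 := by
  simp [lawSum, Finset.Icc_eq_empty_of_lt hab, Measure.map_const]

lemma probNeZero_sum_le {Y : ℤ → Ω → ℤ} (a b : ℤ) :
    probNeZero P (fun ω => ∑ j ∈ Finset.Icc a b, Y j ω)
      ≤ ∑ j ∈ Finset.Icc a b, probNeZero P (Y j) := by
  refine le_trans (measureReal_mono (s₂ := ⋃ j ∈ Finset.Icc a b, {ω | Y j ω ≠ 0}) ?_
    (measure_ne_top _ _))
    (measureReal_biUnion_finset_le _ _)
  intro ω hω
  obtain ⟨j, hj, hne⟩ := Finset.exists_ne_zero_of_sum_ne_zero hω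
  exact Set.mem_biUnion hj hne

variable {P} in
lemma lawSum_conv {N : ℤ → Ω → ℤ} {n : ℤ} (hN : ∀ i : ℤ, 1 ≤ i → i ≤ n → Measurable (N i))
    (hind : iIndepFun (fun i : Set.Icc (1 : ℤ) n => N i) P) {a b c : ℤ} (ha : 1 ≤ a)
    (hab : a ≤ b + 1) (hbc : b ≤ c) (hc : c ≤ n) :
    lawSum P N a c = (lawSum P N a b).conv (lawSum P N (b + 1) c) := by
  have hI : Indep (blockSigma N (Set.Icc a b)) (blockSigma N (Set.Icc (b + 1) c)) P := by
    refine indep_blockSigma (I := Set.Icc 1 n) (fun j hj => hN j hj.1 hj.2) hind ?_ ?_ ?_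
    · exact Set.Icc_subset_Icc ha (hbc.trans hc)
    · exact Set.Icc_subset_Icc (by omega) hc
    · rw [Set.disjoint_left]
      intro j h1 h2
      have := h1.2
      have := h2.1
      omega
  have hm : ∀ a b : ℤ, Measurable[blockSigma N (Set.Icc a b)]
      fun ω => ∑ j ∈ Finset.Icc a b, N j ω := fun a b => by
    refine Finset.measurable_fun_sum _ fun j hj => ?_
    exact measurable_blockSigma N (Finset.mem_Icc.mp hj)
  have hf := indepFun_of_indep hI (hm a b) (hm (b + 1) c)
  have h1 : Measurable fun ω => ∑ j ∈ Finset.Icc a b, N j ω :=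
    measurable_sum_Icc fun j h1 h2 => hN j (by omega) (by omega)
  have h2 : Measurable fun ω => ∑ j ∈ Finset.Icc (b + 1) c, N j ω :=
    measurable_sum_Icc fun j h1 h2 => hN j (by omega) (by omega)
  rw [lawSum, lawSum, lawSum, ← hf.map_add_eq_map_conv_map h1 h2]
  congr 1
  funext ω
  exact sum_Icc_split _ hab hbc

end LawSum

/-! ### The sum of the `N_i`: its law and its atom at `0`. -/

section CompoundPoissonSum

variable {Ω : Type*} [MeasurableSpace Ω] {P : Measure Ω}
  {X N : ℤ → Ω → ℤ} {n : ℕ}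

lemma cpMix_univ_le (hX : ∀ i : ℤ, 1 ≤ i → i ≤ n → Measurable (X i)) :
    cpMix P X n Set.univ ≤ 1 := by
  have h0 : 0 ≤ cpRate P X n := Finset.sum_nonneg fun i _ => probNeZero_nonneg P (X i)
  rw [cpMix, Measure.finsetSum_apply]
  calc _ ≤ ∑ i ∈ Finset.Icc (1 : ℤ) n, ENNReal.ofReal (probNeZero P (X i) / cpRate P X n) := by
        refine Finset.sum_le_sum fun i hi => ?_
        rw [Finset.mem_Icc] at hi
        rw [Measure.smul_apply, smul_eq_mul]
        exact mul_le_of_le_one_right' (condLawNeZero_univ_le P (hX i hi.1 hi.2))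
    _ = ENNReal.ofReal (cpRate P X n / cpRate P X n) := by
        rw [← ENNReal.ofReal_sum_of_nonneg fun i _ => div_nonneg (probNeZero_nonneg P _) h0,
          ← Finset.sum_div, cpRate]
    _ ≤ 1 := by
        rw [← ENNReal.ofReal_one]
        exact ENNReal.ofReal_le_ofReal (div_self_le_one _)

/-- Keeping the factor `cpRate` covers rate `0` as well, where every `p_i` vanishes. -/
lemma cpRate_mul_intCharFun_cpMix (t : ℝ) :
    (cpRate P X n : ℂ) * intCharFun (cpMix P X n) t
      = ∑ i ∈ Finset.Icc (1 : ℤ) n,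
          (probNeZero P (X i) : ℂ) * intCharFun (condLawNeZero P (X i)) t := by
  have h0 : ∀ i ∈ Finset.Icc (1 : ℤ) n, 0 ≤ probNeZero P (X i) :=
    fun i _ => probNeZero_nonneg P (X i)
  by_cases hl : cpRate P X n = 0
  · rw [hl, Complex.ofReal_zero, zero_mul, Finset.sum_eq_zero]
    intro i hi
    rw [(Finset.sum_eq_zero_iff_of_nonneg h0).mp hl i hi]
    simp
  · rw [intCharFun_eq_integral, cpMix, integral_finsetSum_measure fun i _ =>
      (integrable_cexp _ t).smul_measure ENNReal.ofReal_ne_top, Finset.mul_sum]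
    refine Finset.sum_congr rfl fun i hi => ?_
    have hl0 : 0 ≤ cpRate P X n := Finset.sum_nonneg h0
    rw [integral_smul_measure, ENNReal.toReal_ofReal (div_nonneg (h0 i hi) hl0),
      ← intCharFun_eq_integral, Complex.real_smul, ← mul_assoc]
    congr 1
    rw [← Complex.ofReal_mul, mul_div_cancel₀ _ hl]

variable [IsProbabilityMeasure P]

lemma intCharFun_lawSum (hX : ∀ i : ℤ, 1 ≤ i → i ≤ n → Measurable (X i))
    (hN : ∀ i : ℤ, 1 ≤ i → i ≤ n → Measurable (N i))
    (hind : iIndepFun (fun i : Set.Icc (1 : ℤ) n => N i) P)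
    (hlaw : ∀ i : ℤ, 1 ≤ i → i ≤ n →
      P.map (N i) = compoundPoisson (probNeZero P (X i)) (condLawNeZero P (X i)))
    (t : ℝ) (b : ℕ) (hb : b ≤ n) :
    intCharFun (lawSum P N 1 b) t = Complex.exp (∑ i ∈ Finset.Icc (1 : ℤ) b,
      ((probNeZero P (X i) : ℂ) * intCharFun (condLawNeZero P (X i)) t - probNeZero P (X i))) := by
  induction b with
  | zero =>
    rw [lawSum_of_lt P N (by simp), intCharFun_dirac_zero]
    simp
  | succ b ih =>
    have hb' : ((b + 1 : ℕ) : ℤ) = (b : ℤ) + 1 := by push_cast; rfl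
    have hbn : (b : ℤ) + 1 ≤ n := by omega
    have := isProbabilityMeasure_lawSum P (Y := N) (a := 1) (b := b)
      fun j h1 h2 => hN j h1 (by omega)
    have := isProbabilityMeasure_lawSum P (Y := N) (a := b + 1) (b := b + 1)
      fun j h1 h2 => hN j (by omega) (by omega)
    rw [hb', lawSum_conv hN hind le_rfl (by omega) (show (b : ℤ) ≤ b + 1 by omega) hbn,
      intCharFun_conv, ih (by omega), lawSum_self, hlaw _ (by omega) hbn,
      intCharFun_compoundPoisson (probNeZero_nonneg P _) _
        (condLawNeZero_univ_le P (hX _ (by omega) hbn)),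
      sum_Icc_split _ (show (1 : ℤ) ≤ b + 1 by omega) (show (b : ℤ) ≤ b + 1 by omega),
      Finset.Icc_self, Finset.sum_singleton, Complex.exp_add]

/-- The sum of the independent compound Poisson variables `N_1, …, N_n` is compound Poisson. -/
lemma lawSum_eq_compoundPoisson (hX : ∀ i : ℤ, 1 ≤ i → i ≤ n → Measurable (X i))
    (hN : ∀ i : ℤ, 1 ≤ i → i ≤ n → Measurable (N i))
    (hind : iIndepFun (fun i : Set.Icc (1 : ℤ) n => N i) P)
    (hlaw : ∀ i : ℤ, 1 ≤ i → i ≤ n →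
      P.map (N i) = compoundPoisson (probNeZero P (X i)) (condLawNeZero P (X i))) :
    lawSum P N 1 n = compoundPoisson (cpRate P X n) (cpMix P X n) := by
  have h0 : 0 ≤ cpRate P X n := Finset.sum_nonneg fun i _ => probNeZero_nonneg P (X i)
  have hmix := cpMix_univ_le (P := P) hX
  have : IsFiniteMeasure (cpMix P X n) := ⟨hmix.trans_lt (by simp)⟩
  have := isFiniteMeasure_compoundPoisson h0 _ hmix
  have := isProbabilityMeasure_lawSum P (Y := N) (a := 1) (b := n) hN
  refine eq_of_intCharFun_eq fun t => ?_
  rw [intCharFun_lawSum hX hN hind hlaw t n le_rfl, intCharFun_compoundPoisson h0 _ hmix,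
    cpRate_mul_intCharFun_cpMix, Finset.sum_sub_distrib, cpRate]
  push_cast
  rfl

/-- Each `N_j` vanishes with probability at least `e^{-p_j}`, the chance of no Poisson event, and by
independence these bounds multiply. The block is described by its length `d` to allow induction. -/
lemma exp_neg_le_lawSum_zero
    (hN : ∀ i : ℤ, 1 ≤ i → i ≤ n → Measurable (N i))
    (hind : iIndepFun (fun i : Set.Icc (1 : ℤ) n => N i) P)
    (hlaw : ∀ i : ℤ, 1 ≤ i → i ≤ n →
      P.map (N i) = compoundPoisson (probNeZero P (X i)) (condLawNeZero P (X i)))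
    {a : ℤ} (ha : 1 ≤ a) (d : ℕ) (hd : a + d ≤ n + 1) :
    Real.exp (-∑ j ∈ Finset.Icc a (a + d - 1), probNeZero P (X j))
      ≤ (lawSum P N a (a + d - 1)).real {0} := by
  induction d with
  | zero =>
    rw [lawSum_of_lt P N (show a + ((0 : ℕ) : ℤ) - 1 < a by simp)]
    simp [Measure.real]
  | succ d ih =>
    have hc : a + ((d + 1 : ℕ) : ℤ) - 1 = (a + d - 1) + 1 := by push_cast; ring
    push_cast at hd
    set b := a + d - 1 with hb
    have hbn : b + 1 ≤ n := by omega
    have := isProbabilityMeasure_lawSum P (Y := N) (a := a) (b := b)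
      fun j h1 h2 => hN j (by omega) (by omega)
    have := isProbabilityMeasure_lawSum P (Y := N) (a := b + 1) (b := b + 1)
      fun j h1 h2 => hN j (by omega) (by omega)
    have h1 : Real.exp (-probNeZero P (X (b + 1))) ≤ (lawSum P N (b + 1) (b + 1)).real {0} := by
      rw [lawSum_self, hlaw _ (by omega) hbn, Measure.real]
      have h2 := exp_neg_le_compoundPoisson_zero (probNeZero P (X (b + 1)))
        (condLawNeZero P (X (b + 1)))
      rw [← hlaw _ (by omega) hbn] at h2 ⊢
      have := Measure.isProbabilityMeasure_map (μ := P) (hN (b + 1) (by omega) hbn).aemeasurable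
      exact (ENNReal.ofReal_le_iff_le_toReal (measure_ne_top _ _)).mp h2
    have h3 : ∀ μ ν : Measure ℤ, [IsFiniteMeasure μ] → [IsFiniteMeasure ν] →
        μ.real {0} * ν.real {0} ≤ (μ.conv ν).real {0} := fun μ ν _ _ => by
      rw [Measure.real, Measure.real, ← ENNReal.toReal_mul, Measure.real]
      refine ENNReal.toReal_mono (measure_ne_top _ _) ?_
      rw [Measure.conv, Measure.map_apply measurable_add (measurableSet_singleton 0),
        ← Measure.prod_prod]
      refine measure_mono ?_
      rintro ⟨x, y⟩ ⟨hx, hy⟩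
      simp_all
    rw [hc, lawSum_conv hN hind ha (by omega) (show b ≤ b + 1 by omega) hbn,
      sum_Icc_split _ (show a ≤ b + 1 by omega) (show b ≤ b + 1 by omega), neg_add, Real.exp_add,
      Finset.Icc_self, Finset.sum_singleton]
    exact (mul_le_mul (ih (by omega)) h1 (Real.exp_pos _).le measureReal_nonneg).trans (h3 _ _)

end CompoundPoissonSum

/-! ### Moments of `N_i` and finiteness of `zeta2`. -/

section Moments

variable {Ω : Type*} [MeasurableSpace Ω] {P : Measure Ω}

lemma memLp_two_iff_secondMoment {Y : Ω → ℤ} (hY : Measurable Y) :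
    MemLp (fun ω => (Y ω : ℝ)) 2 P ↔ secondMoment (P.map Y) ≠ ⊤ := by
  have hm : AEStronglyMeasurable (fun ω => (Y ω : ℝ)) P :=
    ((measurable_of_countable (fun x : ℤ => (x : ℝ))).comp hY).aestronglyMeasurable
  rw [memLp_two_iff_integrable_sq hm, ← integrable_sq_iff,
    integrable_map_measure (measurable_of_countable _).aestronglyMeasurable hY.aemeasurable]
  rfl

lemma integral_cast_map {Y : Ω → ℤ} (hY : Measurable Y) :
    ∫ x : ℤ, (x : ℝ) ∂P.map Y = ∫ ω, (Y ω : ℝ) ∂P :=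
  integral_map hY.aemeasurable (measurable_of_countable _).aestronglyMeasurable

variable {X N : Ω → ℤ}

lemma map_Iio_zero_of_compoundPoisson (hX : Measurable X)
    (hlaw : P.map N = compoundPoisson (probNeZero P X) (condLawNeZero P X))
    (hXnonneg : ∀ ω, 0 ≤ X ω) : P.map N (Set.Iio 0) = 0 := by
  rw [hlaw]
  exact compoundPoisson_Iio_zero _ (condLawNeZero_Iio_zero P hX hXnonneg)

variable [IsProbabilityMeasure P]

lemma memLp_two_of_compoundPoisson (hX : Measurable X) (hN : Measurable N)
    (hlaw : P.map N = compoundPoisson (probNeZero P X) (condLawNeZero P X))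
    (hXmom : MemLp (fun ω => (X ω : ℝ)) 2 P) :
    MemLp (fun ω => (N ω : ℝ)) 2 P := by
  rw [memLp_two_iff_secondMoment hN, hlaw]
  exact secondMoment_compoundPoisson_ne_top (probNeZero_nonneg P X) _
    (condLawNeZero_univ_le P hX)
    (secondMoment_condLawNeZero_ne_top P hX ((memLp_two_iff_secondMoment hX).mp hXmom))

lemma integral_cast_eq_of_compoundPoisson (hX : Measurable X) (hN : Measurable N)
    (hlaw : P.map N = compoundPoisson (probNeZero P X) (condLawNeZero P X))
    (hXmom : MemLp (fun ω => (X ω : ℝ)) 2 P) :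
    ∫ ω, (N ω : ℝ) ∂P = ∫ ω, (X ω : ℝ) ∂P := by
  have hs := (memLp_two_iff_secondMoment hX).mp hXmom
  have hi : Integrable (fun x : ℤ => (x : ℝ)) (P.map X) :=
    integrable_cast_of_sq ((integrable_sq_iff _).mpr hs)
  rw [← integral_cast_map hN, ← integral_cast_map hX, integral_map_eq_condLawNeZero P hX hi, hlaw]
  by_cases hp : probNeZero P X = 0
  · simp [hp, compoundPoisson_zero_left]
  · have := isProbabilityMeasure_condLawNeZero P hX hp
    rw [integral_cast_compoundPoisson (probNeZero_nonneg P X) _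
      (secondMoment_condLawNeZero_ne_top P hX hs)]
    simp

/-- For nonnegative `T` and `X` with finite second moments, and `N` the compound Poisson
counterpart of `X`, the sum defining `zeta2` of the distributions of `T + X` and `T + N`
converges. -/
lemma summable_cdfDiffTail_of_compoundPoisson (hX : Measurable X) (hN : Measurable N)
    (hlaw : P.map N = compoundPoisson (probNeZero P X) (condLawNeZero P X))
    {T : Ω → ℤ} (hT : Measurable T)
    (hXmom : MemLp (fun ω => (X ω : ℝ)) 2 P) (hTmom : MemLp (fun ω => (T ω : ℝ)) 2 P)
    (hXnonneg : ∀ ω, 0 ≤ X ω) (hTnonneg : ∀ ω, 0 ≤ T ω) :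
    (Summable fun u : ℤ => (P.map fun ω => T ω + X ω).real (Set.Iic u)
      - (P.map fun ω => T ω + N ω).real (Set.Iic u))
    ∧ Summable (cdfDiffTail (P.map fun ω => T ω + X ω) (P.map fun ω => T ω + N ω)) := by
  have hTX : Measurable fun ω => T ω + X ω := hT.add hX
  have hTN : Measurable fun ω => T ω + N ω := hT.add hN
  have := Measure.isProbabilityMeasure_map (μ := P) hTX.aemeasurable
  have := Measure.isProbabilityMeasure_map (μ := P) hTN.aemeasurable
  have hNmom := memLp_two_of_compoundPoisson hX hN hlaw hXmom
  have h1 : (P.map fun ω => T ω + X ω) (Set.Iio 0) = 0 := by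
    rw [Measure.map_apply hTX measurableSet_Iio]
    convert measure_empty (μ := P)
    ext ω
    simpa using add_nonneg (hTnonneg ω) (hXnonneg ω)
  have h2 : (P.map fun ω => T ω + N ω) (Set.Iio 0) = 0 := by
    have h3 := map_Iio_zero_of_compoundPoisson hX hlaw hXnonneg
    rw [Measure.map_apply hTN measurableSet_Iio]
    rw [Measure.map_apply hN measurableSet_Iio] at h3
    refine measure_mono_null (fun ω hω => ?_) h3
    have := hTnonneg ω
    simp only [Set.mem_preimage, Set.mem_Iio] at hω ⊢
    omega
  have h3 : MemLp (fun ω => ((T ω + X ω : ℤ) : ℝ)) 2 P := by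
    push_cast
    exact hTmom.add hXmom
  have h4 : MemLp (fun ω => ((T ω + N ω : ℤ) : ℝ)) 2 P := by
    push_cast
    exact hTmom.add hNmom
  have h5 := (integrable_sq_iff _).mpr ((memLp_two_iff_secondMoment hTX).mp h3)
  have h6 := (integrable_sq_iff _).mpr ((memLp_two_iff_secondMoment hTN).mp h4)
  refine ⟨summable_cdf_sub h1 h2 h5 h6, summable_cdfDiffTail h1 h2 h5 h6 ?_⟩
  rw [integral_cast_map hTX, integral_cast_map hTN]
  push_cast
  rw [integral_add (hTmom.integrable one_le_two) (hXmom.integrable one_le_two),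
    integral_add (hTmom.integrable one_le_two) (hNmom.integrable one_le_two),
    integral_cast_eq_of_compoundPoisson hX hN hlaw hXmom]

end Moments

/-! ### The Lindeberg step for `k`-dependent variables. -/

section Dependence

variable {Ω : Type*} [MeasurableSpace Ω] {P : Measure Ω} [IsProbabilityMeasure P]

/-- The Lindeberg step for a sequence `X` for which `X j` depends only on `Z_j, …, Z_{j+k-1}`. -/
lemma abs_lindeberg_step_lawSum_le {k : ℕ} (hk : 1 ≤ k) {Z : ℤ → Ω → ℝ}
    (hZ : ∀ j, 1 ≤ j → Measurable (Z j)) (hZind : iIndepFun (fun j : Set.Ici (1 : ℤ) => Z j) P)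
    {X : ℤ → Ω → ℤ} {i : ℤ} (hi : 1 ≤ i)
    (hXblock : ∀ j ≤ i, ∀ S : Set ℤ, (∀ z, 1 ≤ z → j ≤ z → z < j + k → z ∈ S) →
      Measurable[blockSigma Z S] (X j))
    (hX0 : ∀ j < 1, ∀ ω, X j ω = 0)
    (ρ ν q : Measure ℤ) [IsProbabilityMeasure ρ] [IsProbabilityMeasure ν] [IsProbabilityMeasure q]
    (hq : q = compoundPoisson (probNeZero P (X i)) (condLawNeZero P (X i))) (E : Set ℤ) :
    |((lawSum P X 1 i).conv ν).real E - (((lawSum P X 1 (i - 1)).conv q).conv ν).real E|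
      ≤ |((ρ.conv ν).conv (lawSum P X (i - 2 * k + 2) i)).real E
          - ((ρ.conv ν).conv ((lawSum P X (i - 2 * k + 2) (i - 1)).conv q)).real E|
        + 2 * ((tvDist (lawSum P X 1 (i - 3 * k + 2)) ρ
            + ∑ j ∈ Finset.Icc (i - 3 * k + 3) (i - 2 * k + 1), probNeZero P (X j))
          * (2 * P.real {ω | (∃ j ∈ Finset.Icc (i - k + 1) (i - 1), X j ω ≠ 0) ∧ X i ω ≠ 0}
            + 2 * probNeZero P (X i) * ∑ j ∈ Finset.Icc (i - k + 1) (i - 1), probNeZero P (X j)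
            + probNeZero P (X i) ^ 2)) := by
  have hk' : (1 : ℤ) ≤ k := by exact_mod_cast hk
  -- `B`, `U` and `V` span `k - 1` indices each, the shortest gaps that make blocks on either side
  -- functions of disjoint sets of `Z`'s.
  let A : Ω → ℤ := fun ω => ∑ j ∈ Finset.Icc 1 (i - 3 * k + 2), X j ω
  let B : Ω → ℤ := fun ω => ∑ j ∈ Finset.Icc (i - 3 * k + 3) (i - 2 * k + 1), X j ω
  let U : Ω → ℤ := fun ω => ∑ j ∈ Finset.Icc (i - 2 * k + 2) (i - k), X j ω
  let V : Ω → ℤ := fun ω => ∑ j ∈ Finset.Icc (i - k + 1) (i - 1), X j ω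
  -- For small `i` some cut points lie below `1`. As `X` vanishes there, sums may start at `-3k`,
  -- below every cut, and interval splitting applies uniformly.
  have hlow : ∀ c : ℤ, ∀ ω,
      ∑ j ∈ Finset.Icc 1 c, X j ω = ∑ j ∈ Finset.Icc (-(3 * k : ℤ)) c, X j ω :=
    fun c ω => Finset.sum_subset (Finset.Icc_subset_Icc_left (by omega)) fun j hj hj' => by
      simp only [Finset.mem_Icc] at hj hj'
      exact hX0 j (by omega) ω
  have hUV : ∀ ω, U ω + V ω = ∑ j ∈ Finset.Icc (i - 2 * k + 2) (i - 1), X j ω := fun ω => by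
    rw [sum_Icc_split _ (show i - 2 * k + 2 ≤ i - k + 1 by omega) (show i - k ≤ i - 1 by omega)]
  have hABUV : ∀ ω, A ω + B ω + U ω + V ω = ∑ j ∈ Finset.Icc 1 (i - 1), X j ω := fun ω => by
    rw [add_assoc (A ω + B ω), hUV]
    simp only [A, B]
    rw [hlow, hlow, sum_Icc_split _ (show -(3 * k : ℤ) ≤ i - 2 * k + 1 + 1 by omega)
      (show i - 2 * k + 1 ≤ i - 1 by omega),
      sum_Icc_split _ (show -(3 * k : ℤ) ≤ i - 3 * k + 2 + 1 by omega)
      (show i - 3 * k + 2 ≤ i - 2 * k + 1 by omega)]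
    ring_nf
  have hlast : ∀ a ≤ i, ∀ ω, ∑ j ∈ Finset.Icc a i, X j ω
      = ∑ j ∈ Finset.Icc a (i - 1), X j ω + X i ω := fun a ha ω => by
    rw [sum_Icc_split _ (show a ≤ i - 1 + 1 by omega) (show i - 1 ≤ i by omega), sub_add_cancel,
      Finset.Icc_self, Finset.sum_singleton]
  have hsum : ∀ (a b : ℤ) (S : Set ℤ), b ≤ i → (∀ z, 1 ≤ z → a ≤ z → z < b + k → z ∈ S) →
      Measurable[blockSigma Z S] fun ω => ∑ j ∈ Finset.Icc a b, X j ω := fun a b S hb hS => by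
    refine Finset.measurable_fun_sum _ fun j hj => ?_
    rw [Finset.mem_Icc] at hj
    exact hXblock j (by omega) S fun z h1 h2 h3 => hS z h1 (by omega) (by omega)
  have hle : ∀ S ⊆ Set.Ici (1 : ℤ), blockSigma Z S ≤ ‹MeasurableSpace Ω› :=
    fun S hS => blockSigma_le fun j hj => hZ j (hS hj)
  have hmeas : ∀ a b : ℤ, b ≤ i → Measurable fun ω => ∑ j ∈ Finset.Icc a b, X j ω :=
    fun a b hb => (hsum a b (Set.Ici 1) hb fun z h _ _ => h).mono (hle _ subset_rfl) le_rfl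
  have hXi : Measurable (X i) :=
    (hXblock i le_rfl (Set.Ici 1) fun z h _ _ => h).mono (hle _ subset_rfl) le_rfl
  have hA : Measurable A := hmeas _ _ (by omega)
  have hB : Measurable B := hmeas _ _ (by omega)
  have hU : Measurable U := hmeas _ _ (by omega)
  have hV : Measurable V := hmeas _ _ (by omega)
  have hind : ∀ c : ℤ, Indep (blockSigma Z {z | 1 ≤ z ∧ z ≤ c})
      (blockSigma Z {z | 1 ≤ z ∧ c < z}) P := fun c => by
    refine indep_blockSigma (I := Set.Ici 1) (fun j hj => hZ j hj) hZind (fun z hz => hz.1)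
      (fun z hz => hz.1) ?_
    rw [Set.disjoint_left]
    intro z h1 h2
    exact absurd h1.2 (not_le.mpr h2.2)
  -- The last summand of `A` reads `Z` up to index `i-2k+1`, and `U` starts right after it. The
  -- later cuts `i-k` and `i-1` arise in the same way from `B` and `U`.
  have hAT : IndepFun A (fun ω => (U ω, V ω, X i ω)) P := by
    refine indepFun_of_indep (hind (i - 2 * k + 1)) (hsum _ _ _ (by omega) ?_)
      (Measurable.prodMk (hsum _ _ _ (by omega) ?_) (Measurable.prodMk
        (hsum _ _ _ (by omega) ?_) (hXblock i le_rfl _ ?_)))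
    all_goals intro z h1 h2 h3; exact ⟨h1, by omega⟩
  have hBT : IndepFun B (fun ω => (V ω, X i ω)) P := by
    refine indepFun_of_indep (hind (i - k)) (hsum _ _ _ (by omega) ?_)
      (Measurable.prodMk (hsum _ _ _ (by omega) ?_) (hXblock i le_rfl _ ?_))
    all_goals intro z h1 h2 h3; exact ⟨h1, by omega⟩
  have hUX : IndepFun U (X i) P := by
    refine indepFun_of_indep (hind (i - 1)) (hsum _ _ _ (by omega) ?_) (hXblock i le_rfl _ ?_)
    all_goals intro z h1 h2 h3; exact ⟨h1, by omega⟩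
  have hWX : IndepFun (fun ω => A ω + B ω + U ω) (X i) P := by
    refine indepFun_of_indep (hind (i - 1)) (Measurable.add (Measurable.add
      (hsum _ _ _ (by omega) ?_) (hsum _ _ _ (by omega) ?_)) (hsum _ _ _ (by omega) ?_))
      (hXblock i le_rfl _ ?_)
    all_goals intro z h1 h2 h3; exact ⟨h1, by omega⟩
  have key := abs_lindeberg_step_le hA hB hU hV hXi hAT hBT hWX hUX ρ ν q hq E
  simp only [hABUV, hUV, ← hlast 1 hi, ← hlast (i - 2 * k + 2) (by omega)] at key
  refine key.trans (add_le_add le_rfl ?_)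
  rw [mul_assoc]
  have hB' : probNeZero P B ≤ _ := probNeZero_sum_le P (Y := X) (i - 3 * k + 3) (i - 2 * k + 1)
  have hV' : probNeZero P V ≤ _ := probNeZero_sum_le P (Y := X) (i - k + 1) (i - 1)
  have hVX : P.real {ω | V ω ≠ 0 ∧ X i ω ≠ 0}
      ≤ P.real {ω | (∃ j ∈ Finset.Icc (i - k + 1) (i - 1), X j ω ≠ 0) ∧ X i ω ≠ 0} :=
    measureReal_mono (fun ω hω => ⟨Finset.exists_ne_zero_of_sum_ne_zero hω.1, hω.2⟩)
      (measure_ne_top _ _)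
  have htv : 0 ≤ tvDist (P.map A) ρ := Real.iSup_nonneg fun _ => abs_nonneg _
  have hp := probNeZero_nonneg P (X i)
  have hpB := probNeZero_nonneg P B
  have hpV := probNeZero_nonneg P V
  have hAlaw : P.map A = lawSum P X 1 (i - 3 * k + 2) := rfl
  rw [hAlaw] at htv ⊢
  have hBsum := hpB.trans hB'
  gcongr

end Dependence

end CPApprox

/-! ### The main theorem: telescoping and smoothing. -/

theorem mainTheorem1 {Ω : Type*} [MeasurableSpace Ω] (P : Measure Ω) [IsProbabilityMeasure P]
    (k n : ℕ) (hk : 1 ≤ k)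
    -- the independent random variables `Z_1, Z_2, …`
    (Z : ℤ → Ω → ℝ) (hZmeas : ∀ j, 1 ≤ j → Measurable (Z j))
    (hZindep : iIndepFun (fun j : Set.Ici (1 : ℤ) => Z j) P)
    -- `X_i = h_i(Z_i, …, Z_{i+k-1})` for `1 ≤ i ≤ n`, and `X_i = 0` for `i < 1`
    (h : ℤ → (Fin k → ℝ) → ℤ) (hh : ∀ i : ℤ, 1 ≤ i → i ≤ n → Measurable (h i))
    (X : ℤ → Ω → ℤ)
    (hX : ∀ i : ℤ, 1 ≤ i → i ≤ n → ∀ ω, X i ω = h i (fun l : Fin k => Z (i + (l : ℕ)) ω))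
    (hX0 : ∀ i : ℤ, i < 1 → ∀ ω, X i ω = 0)
    (hXnonneg : ∀ i : ℤ, 1 ≤ i → i ≤ n → ∀ ω, 0 ≤ X i ω)
    (hXmom : ∀ i : ℤ, 1 ≤ i → i ≤ n → MemLp (fun ω => (X i ω : ℝ)) 2 P)
    -- `N_1, …, N_n` independent, independent of the `Z_j`, with `N_i ∼ CP(p_i, G_i)`
    (N : ℤ → Ω → ℤ) (hNmeas : ∀ i : ℤ, 1 ≤ i → i ≤ n → Measurable (N i))
    (hNindep : iIndepFun (fun i : Set.Icc (1 : ℤ) n => N i) P)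
    (hNZ : IndepFun (fun ω (i : Set.Icc (1 : ℤ) n) => N i ω)
      (fun ω (j : Set.Ici (1 : ℤ)) => Z j ω) P)
    (hNlaw : ∀ i : ℤ, 1 ≤ i → i ≤ n →
      P.map (N i) = CPApprox.compoundPoisson (CPApprox.probNeZero P (X i))
        (CPApprox.condLawNeZero P (X i)))
    -- `m = max_{1 ≤ i ≤ n} ∑_{j=i-3k+3}^i p_j < log 2`
    (m : ℝ)
    (hm : IsGreatest ((fun i : ℤ => ∑ j ∈ Finset.Icc (i - 3 * k + 3) i,
      CPApprox.probNeZero P (X j)) '' Set.Icc (1 : ℤ) n) m)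
    (hmlog : m < Real.log 2) :
    CPApprox.tvDist (CPApprox.lawSum P X 1 n)
        (CPApprox.compoundPoisson (CPApprox.cpRate P X n) (CPApprox.cpMix P X n))
      ≤ CPApprox.cTerm P X N k n
        + CPApprox.l1Norm (CPApprox.bdiff (CPApprox.bdiff (CPApprox.massFun
              (CPApprox.compoundPoisson (CPApprox.cpRate P X n) (CPApprox.cpMix P X n)))))
            / (2 * (1 - 2 * (1 - Real.exp (-m))))
          * ∑ i ∈ Finset.Icc (1 : ℤ) n,
              CPApprox.zeta2 (CPApprox.lawSum P X (i - 2 * k + 2) i)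
                (P.map fun ω =>
                  (∑ j ∈ Finset.Icc (i - 2 * k + 2) (i - 1), X j ω) + N i ω) := by
  open CPApprox in
  have hk' : (1 : ℤ) ≤ k := by exact_mod_cast hk
  have hXblock : ∀ j ≤ (n : ℤ), ∀ S : Set ℤ, (∀ z, 1 ≤ z → j ≤ z → z < j + k → z ∈ S) →
      Measurable[blockSigma Z S] (X j) := fun j hj S hS => by
    by_cases hj1 : j < 1
    · rw [show X j = fun _ => 0 from funext (hX0 j hj1)]
      exact measurable_const
    · have hj1' : 1 ≤ j := not_lt.mp hj1
      rw [show X j = _ from funext (hX j hj1' hj)]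
      refine (hh j hj1' hj).comp (@measurable_pi_lambda _ _ _ (blockSigma Z S) _ _ fun l => ?_)
      have := l.2
      exact measurable_blockSigma Z (hS _ (by omega) (by omega) (by omega))
  have hle : ∀ S ⊆ Set.Ici (1 : ℤ), blockSigma Z S ≤ ‹MeasurableSpace Ω› :=
    fun S hS => blockSigma_le fun j hj => hZmeas j (hS hj)
  have hXm : ∀ j ≤ (n : ℤ), Measurable (X j) := fun j hj =>
    (hXblock j hj (Set.Ici 1) fun z h _ _ => h).mono (hle _ subset_rfl) le_rfl
  have hXnn : ∀ j ≤ (n : ℤ), ∀ ω, 0 ≤ X j ω := fun j hj ω => by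
    by_cases hj1 : j < 1
    · exact (hX0 j hj1 ω).ge
    · exact hXnonneg j (not_lt.mp hj1) hj ω
  have hXL2 : ∀ j ≤ (n : ℤ), MemLp (fun ω => (X j ω : ℝ)) 2 P := fun j hj => by
    by_cases hj1 : j < 1
    · simp [hX0 j hj1]
    · exact hXmom j (not_lt.mp hj1) hj
  have hCP := lawSum_eq_compoundPoisson (fun i _ h => hXm i h) hNmeas hNindep hNlaw
  rw [← hCP]
  set K := l1Norm (bdiff (bdiff (massFun (lawSum P N 1 n)))) with hK
  set c := 1 - 2 * (1 - Real.exp (-m)) with hc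
  -- `m < log 2` says exactly that `e^{-m} > 1/2`.
  have hcpos : 0 < c := by
    have h1 : Real.exp (-Real.log 2) < Real.exp (-m) := Real.exp_lt_exp.mpr (by linarith)
    rw [Real.exp_neg, Real.exp_log (by norm_num)] at h1
    norm_num at h1
    linarith
  have hNprob : ∀ a b : ℤ, 1 ≤ a → b ≤ n → IsProbabilityMeasure (lawSum P N a b) :=
    fun a b ha hb => isProbabilityMeasure_lawSum P fun j h1 h2 => hNmeas j (by omega) (by omega)
  have hXprob : ∀ a b : ℤ, b ≤ n → IsProbabilityMeasure (lawSum P X a b) :=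
    fun a b hb => isProbabilityMeasure_lawSum P fun j h1 h2 => hXm j (by omega)
  have hstep : ∀ E : Set ℤ, ∀ i ∈ Finset.Icc (1 : ℤ) n,
      |((lawSum P X 1 i).conv (lawSum P N (i + 1) n)).real E
        - ((lawSum P X 1 (i - 1)).conv (lawSum P N i n)).real E|
      ≤ K / (2 * c) * zeta2 (lawSum P X (i - 2 * k + 2) i)
          (P.map fun ω => (∑ j ∈ Finset.Icc (i - 2 * k + 2) (i - 1), X j ω) + N i ω)
        + 2 * ((tvDist (lawSum P X 1 (i - 3 * k + 2)) (lawSum P N 1 (i - 3 * k + 2))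
            + ∑ j ∈ Finset.Icc (i - 3 * k + 3) (i - 2 * k + 1), probNeZero P (X j))
          * (2 * P.real {ω | (∃ j ∈ Finset.Icc (i - k + 1) (i - 1), X j ω ≠ 0) ∧ X i ω ≠ 0}
            + 2 * probNeZero P (X i) * ∑ j ∈ Finset.Icc (i - k + 1) (i - 1), probNeZero P (X j)
            + probNeZero P (X i) ^ 2)) := by
    intro E i hi
    obtain ⟨hi1, hin⟩ := Finset.mem_Icc.mp hi
    have := hNprob 1 (i - 3 * k + 2) le_rfl (by omega)
    have := hNprob (i + 1) n (by omega) le_rfl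
    have := hNprob i i hi1 hin
    have := hXprob 1 (i - 1) (by omega)
    have := hXprob (i - 2 * k + 2) i hin
    have := hXprob (i - 2 * k + 2) (i - 1) (by omega)
    set ρ := lawSum P N 1 (i - 3 * k + 2) with hρ
    set ν := lawSum P N (i + 1) n with hν
    have hq : lawSum P N i i = compoundPoisson (probNeZero P (X i)) (condLawNeZero P (X i)) := by
      rw [lawSum_self, hNlaw i hi1 hin]
    have key := abs_lindeberg_step_lawSum_le hk hZmeas hZindep hi1
      (fun j hj => hXblock j (hj.trans hin)) (fun j hj => hX0 j hj) ρ ν (lawSum P N i i) hq E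
    rw [Measure.conv_assoc, ← lawSum_conv hNmeas hNindep hi1 (by omega) hin le_rfl] at key
    refine key.trans (add_le_add ?_ le_rfl)
    -- the law of the shorter sum plus `N i` is a convolution
    set T : Ω → ℤ := fun ω => ∑ j ∈ Finset.Icc (i - 2 * k + 2) (i - 1), X j ω with hT
    have hTm : Measurable T := measurable_sum_Icc fun j h1 h2 => hXm j (by omega)
    -- `T` is a function of the `Z_j`, so independence of the families `N` and `Z` makes the law of
    -- `T + N_i` a convolution.
    have hNT : IndepFun (N i) T P := by
      refine indepFun_of_indep ((IndepFun_iff_Indep _ _ _).mp hNZ) ?_ ?_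
      · exact (measurable_pi_apply (⟨i, hi1, hin⟩ : Set.Icc (1 : ℤ) n)).comp
          (comap_measurable fun ω (j : Set.Icc (1 : ℤ) n) => N j ω)
      · have hcomap : blockSigma Z (Set.Ici 1) ≤ MeasurableSpace.comap
            (fun ω (j : Set.Ici (1 : ℤ)) => Z j ω) inferInstance := iSup₂_le fun j hj => by
          refine Measurable.comap_le ?_
          exact (measurable_pi_apply (⟨j, hj⟩ : Set.Ici (1 : ℤ))).comp
            (comap_measurable fun ω (j : Set.Ici (1 : ℤ)) => Z j ω)
        refine Measurable.mono ?_ hcomap le_rfl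
        refine Finset.measurable_fun_sum _ fun j hj => ?_
        exact hXblock j (by have := (Finset.mem_Icc.mp hj).2; omega) _ fun z h _ _ => h
    have hconv : (lawSum P X (i - 2 * k + 2) (i - 1)).conv (lawSum P N i i)
        = P.map fun ω => T ω + N i ω := by
      rw [lawSum_self]
      exact (hNT.symm.map_add_eq_map_conv_map hTm (hNmeas i hi1 hin)).symm
    have hTX : lawSum P X (i - 2 * k + 2) i = P.map fun ω => T ω + X i ω := by
      rw [lawSum]
      congr 1
      funext ω
      rw [sum_Icc_split _ (show i - 2 * k + 2 ≤ i - 1 + 1 by omega) (show i - 1 ≤ i by omega),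
        sub_add_cancel, Finset.Icc_self, Finset.sum_singleton]
    have hTL2 : MemLp (fun ω => (T ω : ℝ)) 2 P := by
      simp only [hT]
      push_cast
      exact memLp_finsetSum _ fun j hj =>
        hXL2 j (by have := (Finset.mem_Icc.mp hj).2; omega)
    obtain ⟨hs1, hs2⟩ := summable_cdfDiffTail_of_compoundPoisson (hXm i hin) (hNmeas i hi1 hin)
      (hNlaw i hi1 hin) hTm (hXL2 i hin) hTL2 (hXnn i hin)
      fun ω => Finset.sum_nonneg fun j hj =>
        hXnn j (by have := (Finset.mem_Icc.mp hj).2; omega) ω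
    rw [← hTX, ← hconv] at hs1 hs2
    rw [← hconv]
    refine (abs_conv_real_sub_le_zeta2 (ρ.conv ν) _ _ (fun x => hs1.subtype _) hs2 E).trans ?_
    have hzeta : 0 ≤ zeta2 (lawSum P X (i - 2 * k + 2) i)
        ((lawSum P X (i - 2 * k + 2) (i - 1)).conv (lawSum P N i i)) :=
      tsum_nonneg fun _ => abs_nonneg _
    -- restoring the missing block of the compound Poisson distribution
    obtain ⟨s, hs⟩ : ∃ s : ℤ, s = max 0 (i - 3 * k + 2) := ⟨_, rfl⟩
    have hρs : ρ = lawSum P N 1 s := by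
      by_cases h0 : 0 ≤ i - 3 * k + 2
      · rw [hρ, hs, max_eq_right h0]
      · rw [hρ, lawSum_of_lt P N (by omega), lawSum_of_lt P N (by omega)]
    have := hNprob (s + 1) i (by omega) hin
    have := hNprob 1 s le_rfl (by omega)
    have hfull : (ρ.conv ν).conv (lawSum P N (s + 1) i) = lawSum P N 1 n := by
      rw [hρs, Measure.conv_assoc, Measure.conv_comm ν, ← Measure.conv_assoc,
        ← lawSum_conv hNmeas hNindep le_rfl (by omega) (by omega) hin,
        ← lawSum_conv hNmeas hNindep le_rfl (by omega) hin le_rfl]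
    -- The restored block lies inside `[i-3k+3, i]`, the window over which `m` bounds the sum of the
    -- `p_j`.
    have hatom : Real.exp (-m) ≤ (lawSum P N (s + 1) i).real {0} := by
      have h1 := exp_neg_le_lawSum_zero hNmeas hNindep hNlaw (a := s + 1) (by omega)
        (i - s).toNat (by omega)
      rw [show s + 1 + ((i - s).toNat : ℤ) - 1 = i by omega] at h1
      refine le_trans (Real.exp_le_exp.mpr (neg_le_neg ?_)) h1
      refine le_trans ?_ (hm.2 ⟨i, ⟨hi1, hin⟩, rfl⟩)
      exact Finset.sum_le_sum_of_subset_of_nonneg (Finset.Icc_subset_Icc_left (by omega))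
        fun j _ _ => probNeZero_nonneg P _
    have hblock := l1Norm_bdiff_bdiff_le_conv (ρ.conv ν) _ hatom
    rw [hfull, ← hK, ← hc, ← le_div_iff₀ hcpos] at hblock
    calc _ ≤ K / c * zeta2 (lawSum P X (i - 2 * k + 2) i)
          ((lawSum P X (i - 2 * k + 2) (i - 1)).conv (lawSum P N i i)) / 2 := by gcongr
      _ = _ := by rw [mul_comm 2 c, ← div_div]; ring
  refine ciSup_le fun E => ?_
  -- At `i = n` the `N`-part is empty and at `i = 0` the `X`-part is, so the two ends are the laws
  -- being compared.
  have htel := sum_Icc_telescope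
    (fun i => ((lawSum P X 1 i).conv (lawSum P N (i + 1) n)).real E) n
  have := hXprob 1 n le_rfl
  have := hNprob 1 n le_rfl le_rfl
  simp only [sub_add_cancel, zero_add] at htel
  rw [lawSum_of_lt P N (show (n : ℤ) < n + 1 by omega),
    lawSum_of_lt P X (show (0 : ℤ) < 1 by omega),
    Measure.conv_dirac_zero, Measure.dirac_zero_conv] at htel
  rw [← htel]
  refine (Finset.abs_sum_le_sum_abs _ _).trans ((Finset.sum_le_sum (hstep E)).trans (le_of_eq ?_))
  rw [Finset.sum_add_distrib, ← Finset.mul_sum, ← Finset.mul_sum, cTerm, add_comm]
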